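/- For a hypergraph $\mathcal{H}$ on a finite vertex set $V$ (a set of non-empty subsets of $V$, called edges), let $\mathcal{I}(\mathcal{H})$ be its independence complex, the abstract simplicial complex of all $W \subseteq V$ that contain no edge of $\mathcal{H}$. For a simplicial complex $K$ and $i \in \mathbb{Z}$, let $\tilde\beta_i(K) = \dim \tilde H_i(K; \mathbb{Z}_2)$ be its $i$-th reduced Betti number over $\mathbb{Z}_2$; here the empty set is regarded as a face of dimension $-1$. Let $k$ and $n$ be positive integers. The $k$-uniform tight path $P_{n,k}$ on a linearly ordered vertex set $v_1 < \dots < v_n$ has the edges $\{v_{i+1}, \dots, v_{i+k}\}$ for $0 \le i \le n-k$ (no edges if $n<k$). For $n > k$, the $k$-uniform tight cycle $C_{n,k}$ is the hypergraph on $\mathbb{Z}_n$ with the edges $\{i, i+1, \dots, i+k-1\}$ for $i \in \mathbb{Z}_n$. Then for every integer $i$, $$\tilde\beta_i(\mathcal{I}(P_{n,k})) = \begin{cases} 1 & \text{if } i = q(k-1)+k-2 \text{ and } n \in \{q(k+1)+k,\ (q+1)(k+1)\} \text{ for some integer } q \ge 0,\\ 0 & \text{otherwise.} \end{cases}$$ If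 $n > k$, then for every integer $i$, $$\tilde\beta_i(\mathcal{I}(C_{n,k})) = \begin{cases} k & \text{if } i = q(k-1)+k-2 \text{ and } n = (q+1)(k+1) \text{ for some integer } q \ge 0,\\ 1 & \text{if } i = q(k-1)+k+t-3 \text{ and } n = (q+1)(k+1)+t \text{ for some integers } q \ge 0 \text{ and } 1 \le t \le k,\\ 0 & \text{otherwise.} \end{cases}$$ -/

import Mathlib

/-! ### Reduced simplicial homology with coefficients in `ZMod 2`

An abstract simplicial complex is a family of finite sets that is closed under taking subsets,
that is, a `LowerSet (Finset α)`.  The void complex (no face at all) and the empty complex (whose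
only face is `∅`) are different.  The faces of dimension `i : ℤ` are those with `i + 1` elements,
so that `∅` is the face of dimension `-1`. -/

namespace ReducedHomology

/-- The boundary map `σ ↦ ∑ v ∈ σ, σ \ {v}` over `ZMod 2` (there are no signs). -/
noncomputable def boundary (α : Type*) [DecidableEq α] :
    (Finset α →₀ ZMod 2) →ₗ[ZMod 2] (Finset α →₀ ZMod 2) :=
  Finsupp.linearCombination (ZMod 2) fun σ => ∑ v ∈ σ, Finsupp.single (σ.erase v) 1

/-- The `i`-dimensional chains of `K`: the `ZMod 2`-combinations of `i`-dimensional faces. -/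
noncomputable def chains {α : Type*} (K : LowerSet (Finset α)) (i : ℤ) :
    Submodule (ZMod 2) (Finset α →₀ ZMod 2) :=
  Finsupp.supported (ZMod 2) (ZMod 2) {σ : Finset α | σ ∈ K ∧ (σ.card : ℤ) = i + 1}

/-- The `i`-dimensional cycles of the augmented chain complex. -/
noncomputable def cycles {α : Type*} [DecidableEq α] (K : LowerSet (Finset α)) (i : ℤ) :
    Submodule (ZMod 2) (Finset α →₀ ZMod 2) :=
  chains K i ⊓ LinearMap.ker (boundary α)

/-- The `i`-dimensional boundaries of the augmented chain complex. -/
noncomputable def boundaries {α : Type*} [DecidableEq α] (K : LowerSet (Finset α)) (i : ℤ) :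
    Submodule (ZMod 2) (Finset α →₀ ZMod 2) :=
  (chains K (i + 1)).map (boundary α)

theorem boundary_single {α : Type*} [DecidableEq α] (σ : Finset α) :
    boundary α (Finsupp.single σ 1) = ∑ v ∈ σ, Finsupp.single (σ.erase v) 1 := by
  simp [boundary]

theorem boundary_boundary {α : Type*} [DecidableEq α] (c : Finset α →₀ ZMod 2) :
    boundary α (boundary α c) = 0 := by
  suffices h : boundary α ∘ₗ boundary α = 0 from LinearMap.congr_fun h c
  refine Finsupp.lhom_ext' fun σ => LinearMap.ext_ring ?_
  simp only [LinearMap.comp_apply, Finsupp.lsingle_apply, boundary_single, map_sum,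
    LinearMap.zero_apply]
  rw [Finset.sum_sigma']
  refine Finset.sum_involution (fun p _ => ⟨p.2, p.1⟩) ?_ ?_ ?_ ?_
  · rintro ⟨a, b⟩ _
    simp only [Finset.erase_right_comm (a := a) (b := b)]
    rw [← Finsupp.single_add, CharTwo.add_self_eq_zero, Finsupp.single_zero]
  · rintro ⟨a, b⟩ hab _ h
    simp only [Finset.mem_sigma, Finset.mem_erase] at hab
    simp only [Sigma.mk.injEq] at h
    exact hab.2.1 h.1
  · rintro ⟨a, b⟩ hab
    simp only [Finset.mem_sigma, Finset.mem_erase] at hab ⊢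
    exact ⟨hab.2.2, fun h => hab.2.1 h.symm, hab.1⟩
  · rintro ⟨a, b⟩ _
    rfl

theorem boundaries_le_cycles {α : Type*} [DecidableEq α] (K : LowerSet (Finset α)) (i : ℤ) :
    boundaries K i ≤ cycles K i := by
  rintro _ ⟨c, hc, rfl⟩
  refine ⟨?_, boundary_boundary c⟩
  rw [boundary, Finsupp.linearCombination_apply]
  refine Submodule.sum_mem _ fun σ hσ => Submodule.smul_mem _ _ (Submodule.sum_mem _ fun v hv => ?_)
  obtain ⟨hK, hcard⟩ := hc hσ
  refine Finsupp.single_mem_supported _ _ ⟨K.lower (Finset.erase_subset v σ) hK, ?_⟩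
  have := Finset.card_erase_add_one hv
  omega

/-- The `i`-th reduced homology group of `K` over `ZMod 2`: cycles modulo boundaries. -/
noncomputable abbrev homology {α : Type*} [DecidableEq α] (K : LowerSet (Finset α)) (i : ℤ) : Type _ :=
  cycles K i ⧸
    ((boundaries K i).comap (cycles K i).subtype : Submodule (ZMod 2) (cycles K i))

/-- The `i`-th reduced Betti number of `K` over `ZMod 2`. -/
noncomputable def betti {α : Type*} [DecidableEq α] (K : LowerSet (Finset α)) (i : ℤ) : ℕ :=
  Module.finrank (ZMod 2) (homology K i)

/-- For a complex with finitely many faces the homology is finite dimensional, so that the Betti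
number is a true dimension. -/
theorem finite_homology {α : Type*} [DecidableEq α] (K : LowerSet (Finset α))
    (hK : (K : Set (Finset α)).Finite) (i : ℤ) : Module.Finite (ZMod 2) (homology K i) := by
  have hfin : {σ : Finset α | σ ∈ K ∧ (σ.card : ℤ) = i + 1}.Finite := hK.subset fun σ h => h.1
  have := hfin.to_subtype
  have h1 : Module.Finite (ZMod 2) (chains K i) :=
    Module.Finite.equiv (Finsupp.supportedEquivFinsupp
      (M := ZMod 2) (R := ZMod 2) {σ : Finset α | σ ∈ K ∧ (σ.card : ℤ) = i + 1}).symm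
  have h2 : Module.Finite (ZMod 2) (cycles K i) :=
    Submodule.finiteDimensional_of_le (inf_le_left : cycles K i ≤ chains K i)
  infer_instance

end ReducedHomology

namespace Hypergraph

/-- The independence complex: the sets of vertices that contain no edge. -/
def independenceComplex {α : Type*} (H : Hypergraph α) : LowerSet (Finset α) where
  carrier := {W | (W : Set α) ⊆ H.vertexSet ∧ ∀ e ∈ H.edgeSet, ¬ e ⊆ (W : Set α)}
  lower' := fun _ _ hle hW =>
    ⟨(Finset.coe_subset.mpr hle).trans hW.1,
      fun e he h => hW.2 e he (h.trans (Finset.coe_subset.mpr hle))⟩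

/-- The `k`-uniform tight path on the `n` distinct vertices `v 0, …, v (n - 1)`, in this linear
order.  Its edges are the sets of `k` consecutive vertices. -/
def tightPath {α : Type*} {n : ℕ} (v : Fin n ↪ α) (k : ℕ) : Hypergraph α where
  vertexSet := Set.range v
  edgeSet := {e | ∃ i : ℕ, i + k ≤ n ∧ e = v '' {j : Fin n | i ≤ (j : ℕ) ∧ (j : ℕ) < i + k}}
  subset_vertexSet_of_mem_edgeSet' := by
    rintro _ ⟨i, _, rfl⟩
    exact Set.image_subset_range _ _

/-- The tight cycle on `ℤ/nℤ`, with the edges `{i, i + 1, …, i + k - 1}`.  It is `k`-uniform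
when `n ≥ k + 1`, the only case of interest. -/
def tightCycle (n k : ℕ) : Hypergraph (ZMod n) where
  vertexSet := Set.univ
  edgeSet := {e | ∃ i : ZMod n, e = {x | ∃ j : ℕ, j < k ∧ x = i + (j : ZMod n)}}
  subset_vertexSet_of_mem_edgeSet' := fun _ _ => Set.subset_univ _

end Hypergraph

namespace ReducedHomology

/-! ### Homological tools: homotopies, links, cones, skeleta. -/

section Tools

variable {α β : Type*}

/-! The basic move changes the edge set without changing homology. Let `e` be a set of vertices and
`x ∉ e` a vertex such that, for every edge `f` containing `x`, the union `f ∪ e` contains an edge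
avoiding `x`. Then the independent sets containing `e` are closed under adding and removing `x`, so
discarding them, that is, making `e` an edge, preserves homology (`betti_eq_of_toggle`,
`betti_indep_insert`). The same move read backwards deletes edges.

For a path on `m + k + 1` vertices, the edges crossing from the first `m` vertices to the last `k +
1` can be deleted. What remains is a join with the complex of a path on `k + 1` vertices. That
complex has the homology of a simplex boundary on `k` vertices, so the join is a `(k - 1)`-fold
suspension. The cycle on `m + k + 1` vertices likewise reduces to the cycle on `m ≥ k` vertices, by
comparing both with a common larger edge set. Thus `n` drops by `k + 1` and the degree by `k - 1`
(`betti_path_step`, `betti_cycle_step`).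

For paths this leaves fewer than `k` vertices (a full simplex, or `{∅}`) or exactly `k` (a simplex
boundary). For cycles it leaves `k + 1` vertices, where the complex is a skeleton with Betti number
`k`; or `m + k + 1` with `0 < m < k`, again a suspended simplex boundary (`betti_short_cycle`); or
`2 * k + 1`, from which one further step leads to a degenerate cycle on `k` vertices whose edges are
all equal. -/

theorem single_mem_chains {K : LowerSet (Finset α)} {i : ℤ} {σ : Finset α} (hσ : σ ∈ K)
    (hi : (σ.card : ℤ) = i + 1) : Finsupp.single σ (1 : ZMod 2) ∈ chains K i :=
  Finsupp.single_mem_supported _ _ ⟨hσ, hi⟩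

theorem chains_mono {K L : LowerSet (Finset α)} (h : L ≤ K) (i : ℤ) : chains L i ≤ chains K i :=
  Finsupp.supported_mono fun _ hσ => ⟨h hσ.1, hσ.2⟩

/-- A property of linear combinations of faces may be checked on the faces. -/
theorem map_chains_le {K : LowerSet (Finset α)} {i : ℤ} {M : Type*} [AddCommGroup M]
    [Module (ZMod 2) M] (f : (Finset α →₀ ZMod 2) →ₗ[ZMod 2] M) (N : Submodule (ZMod 2) M)
    (h : ∀ σ ∈ K, (σ.card : ℤ) = i + 1 → f (Finsupp.single σ 1) ∈ N) {c : Finset α →₀ ZMod 2}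
    (hc : c ∈ chains K i) : f c ∈ N := by
  rw [chains, Finsupp.supported_eq_span_single] at hc
  have : Submodule.span (ZMod 2) ((fun σ => Finsupp.single σ (1 : ZMod 2)) ''
      {σ : Finset α | σ ∈ K ∧ (σ.card : ℤ) = i + 1}) ≤ N.comap f := by
    rw [Submodule.span_le]
    rintro _ ⟨σ, hσ, rfl⟩
    exact h σ hσ.1 hσ.2
  exact this hc

theorem chains_eq_bot {K : LowerSet (Finset α)} {i : ℤ}
    (h : ∀ σ ∈ K, (σ.card : ℤ) ≠ i + 1) : chains K i = ⊥ := by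
  rw [eq_bot_iff]
  intro c hc
  exact map_chains_le LinearMap.id ⊥ (fun σ hσ h' => (h σ hσ h').elim) hc

theorem finrank_map_add_finrank_inf_ker {F V W : Type*} [Field F] [AddCommGroup V] [Module F V]
    [AddCommGroup W] [Module F W] (f : V →ₗ[F] W) (p : Submodule F V) [Module.Finite F p] :
    Module.finrank F (p.map f) + Module.finrank F (p ⊓ LinearMap.ker f : Submodule F V) =
      Module.finrank F p := by
  have h := LinearMap.finrank_range_add_finrank_ker (f.domRestrict p)
  rw [LinearMap.range_domRestrict, LinearMap.ker_domRestrict] at h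
  rw [← h, ← (Submodule.comapSubtypeEquivOfLe
    (inf_le_left : p ⊓ LinearMap.ker f ≤ p)).finrank_eq, Submodule.comap_inf,
    Submodule.comap_subtype_self, top_inf_eq]

variable [DecidableEq α] [DecidableEq β]

theorem boundary_mem_chains {K : LowerSet (Finset α)} {i : ℤ} {c : Finset α →₀ ZMod 2}
    (hc : c ∈ chains K (i + 1)) : boundary α c ∈ chains K i :=
  (boundaries_le_cycles K i ⟨c, hc, rfl⟩).1

/-- Only the behaviour of `f` on cycles and boundaries matters, so it may shift the degree or change
the vertex type; it need not be a chain map on the whole chain space. -/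
theorem betti_eq_of_map {K : LowerSet (Finset α)} {L : LowerSet (Finset β)} {i j : ℤ}
    (f : (Finset α →₀ ZMod 2) →ₗ[ZMod 2] (Finset β →₀ ZMod 2))
    (hc : ∀ z ∈ cycles K i, f z ∈ cycles L j)
    (hb : ∀ z ∈ boundaries K i, f z ∈ boundaries L j)
    (hsurj : ∀ y ∈ cycles L j, ∃ z ∈ cycles K i, y - f z ∈ boundaries L j)
    (hinj : ∀ z ∈ cycles K i, f z ∈ boundaries L j → z ∈ boundaries K i) :
    betti K i = betti L j := by
  let φ : homology K i →ₗ[ZMod 2] homology L j :=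
    Submodule.mapQ _ _ (f.restrict hc) (fun z hz => hb z.1 hz)
  refine (LinearEquiv.ofBijective φ ⟨?_, ?_⟩).finrank_eq
  · rw [injective_iff_map_eq_zero]
    intro a ha
    obtain ⟨z, rfl⟩ := Submodule.mkQ_surjective _ a
    rw [Submodule.mkQ_apply, Submodule.Quotient.mk_eq_zero]
    replace ha : (Submodule.Quotient.mk (f.restrict hc z) : homology L j) = 0 := ha
    rw [Submodule.Quotient.mk_eq_zero] at ha
    exact hinj z.1 z.2 ha
  · intro b
    obtain ⟨y, rfl⟩ := Submodule.mkQ_surjective _ b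
    obtain ⟨z, hz, h⟩ := hsurj y.1 y.2
    refine ⟨Submodule.Quotient.mk ⟨z, hz⟩, ?_⟩
    change (Submodule.Quotient.mk (f.restrict hc ⟨z, hz⟩) : homology L j) = _
    rw [Submodule.mkQ_apply, eq_comm, Submodule.Quotient.eq]
    exact h

/-- Coning off the faces that satisfy `P` with apex `x`. -/
noncomputable def cone (x : α) (P : Finset α → Prop) [DecidablePred P] :
    (Finset α →₀ ZMod 2) →ₗ[ZMod 2] (Finset α →₀ ZMod 2) :=
  Finsupp.linearCombination (ZMod 2) fun σ =>
    if P σ ∧ x ∉ σ then Finsupp.single (insert x σ) 1 else 0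

theorem cone_single (x : α) (P : Finset α → Prop) [DecidablePred P] (σ : Finset α) :
    cone x P (Finsupp.single σ 1) =
      if P σ ∧ x ∉ σ then Finsupp.single (insert x σ) 1 else 0 := by
  simp [cone]

/-- If the faces of `K` outside `L` are closed under toggling a vertex `x`, then `L` and `K` have
the same homology. -/
theorem betti_eq_of_toggle {K L : LowerSet (Finset α)} (hLK : L ≤ K) (x : α)
    (hx : ∀ σ ∈ K, σ ∉ L → insert x σ ∈ K ∧ σ.erase x ∉ L) (i : ℤ) :
    betti L i = betti K i := by
  classical
  have hcone : ∀ {i : ℤ} {z}, z ∈ chains K i → cone x (fun σ => σ ∈ K ∧ σ ∉ L) z ∈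
      chains K (i + 1) := by
    intro i z hz
    refine map_chains_le _ _ (fun σ hσ hc => ?_) hz
    rw [cone_single]
    split_ifs with h
    · refine single_mem_chains (hx σ h.1.1 h.1.2).1 ?_
      rw [Finset.card_insert_of_notMem h.2]
      push_cast
      omega
    · exact zero_mem _
  have hker : ∀ {i : ℤ} {z}, z ∈ chains L i → cone x (fun σ => σ ∈ K ∧ σ ∉ L) z = 0 := by
    intro i z hz
    refine (Submodule.mem_bot (ZMod 2)).1 (map_chains_le _ ⊥ (fun σ hσ hc => ?_) hz)
    rw [cone_single, if_neg (fun h => h.1.2 hσ)]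
    exact zero_mem _
  -- With `h` the cone operator on the faces outside `L`, the map `id + ∂h + h∂` sends chains of `K`
  -- into `L` and fixes cycles of `L`. It is a retraction up to homotopy, inverse to the inclusion
  -- on homology.
  have hsplit : ∀ {i : ℤ} {z}, z ∈ chains K i → z + boundary α (cone x (fun σ => σ ∈ K ∧ σ ∉ L) z)
      + cone x (fun σ => σ ∈ K ∧ σ ∉ L) (boundary α z) ∈ chains L i := by
    intro i z hz
    refine map_chains_le (LinearMap.id + boundary α ∘ₗ cone x (fun σ => σ ∈ K ∧ σ ∉ L) +
      cone x (fun σ => σ ∈ K ∧ σ ∉ L) ∘ₗ boundary α) _ (fun σ hσ hc => ?_) hz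
    simp only [LinearMap.add_apply, LinearMap.id_apply, LinearMap.comp_apply, boundary_single,
      map_sum, cone_single]
    by_cases hL : σ ∈ L
    · rw [if_neg (fun h => h.1.2 hL), map_zero, add_zero, Finset.sum_eq_zero, add_zero]
      · exact single_mem_chains hL hc
      · intro v hv
        rw [if_neg]
        exact fun h => h.1.2 (L.lower (Finset.erase_subset _ _) hL)
    by_cases hxσ : x ∈ σ
    · rw [if_neg (fun h => h.2 hxσ), map_zero, add_zero, Finset.sum_eq_single x, if_pos,
        Finset.insert_erase hxσ, ZModModule.add_self]
      · exact zero_mem _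
      · exact ⟨⟨K.lower (Finset.erase_subset _ _) hσ, (hx σ hσ hL).2⟩, Finset.notMem_erase _ _⟩
      · intro v hv hvx
        rw [if_neg]
        exact fun h => h.2 (Finset.mem_erase.2 ⟨hvx.symm, hxσ⟩)
      · exact fun h => (h hxσ).elim
    · rw [if_pos ⟨⟨hσ, hL⟩, hxσ⟩, boundary_single, Finset.sum_insert hxσ,
        Finset.erase_insert hxσ, ← add_assoc, ZModModule.add_self, zero_add,
        ← Finset.sum_add_distrib]
      refine Submodule.sum_mem _ fun v hv => ?_
      have hvx : x ≠ v := fun h => hxσ (h ▸ hv)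
      have hxe : x ∉ σ.erase v := fun h => hxσ (Finset.mem_of_mem_erase h)
      rw [Finset.erase_insert_of_ne hvx]
      have hK : insert x (σ.erase v) ∈ K :=
        K.lower (Finset.insert_subset_insert _ (Finset.erase_subset _ _)) (hx σ hσ hL).1
      split_ifs with h
      · rw [ZModModule.add_self]
        exact zero_mem _
      · rw [add_zero]
        refine single_mem_chains ?_ ?_
        · by_contra hn
          have := (hx _ hK hn).2
          rw [Finset.erase_insert hxe] at this
          exact h ⟨⟨K.lower (Finset.erase_subset _ _) hσ, this⟩, hxe⟩
        · rw [Finset.card_insert_of_notMem hxe, Finset.card_erase_add_one hv]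
          exact hc
  refine betti_eq_of_map LinearMap.id (fun z hz => ⟨chains_mono hLK i hz.1, hz.2⟩) ?_ ?_ ?_
  · rintro _ ⟨c, hc, rfl⟩
    exact ⟨c, chains_mono hLK _ hc, rfl⟩
  · intro y hy
    have h := hsplit hy.1
    have h0 : boundary α y = 0 := hy.2
    rw [h0, map_zero, add_zero] at h
    refine ⟨_, ⟨h, ?_⟩, ?_⟩
    · change boundary α _ = 0
      rw [map_add, boundary_boundary, h0, add_zero]
    · rw [LinearMap.id_apply, sub_add_cancel_left]
      exact neg_mem ⟨_, hcone hy.1, rfl⟩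
  · rintro z hz ⟨c, hc, rfl⟩
    have h := hsplit hc
    replace hz : boundary α c ∈ cycles L i := hz
    rw [hker hz.1, add_zero] at h
    exact ⟨_, h, by rw [map_add, boundary_boundary, add_zero]⟩

/-- The link of a vertex. -/
def link (K : LowerSet (Finset α)) (v : α) : LowerSet (Finset α) where
  carrier := {σ | v ∉ σ ∧ insert v σ ∈ K}
  lower' := fun _ _ hle hσ =>
    ⟨fun h => hσ.1 (hle h), K.lower (Finset.insert_subset_insert _ hle) hσ.2⟩

/-- The contracting homotopy of a cone. If `x ∈ σ`, the cone on `σ` is zero by convention, but the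
term `v = x` of the boundary gives `σ` back, so the identity needs no hypothesis on `c`. -/
theorem boundary_cone (x : α) (c : Finset α →₀ ZMod 2) :
    boundary α (cone x (fun _ => True) c) = c + cone x (fun _ => True) (boundary α c) := by
  suffices h : boundary α ∘ₗ cone x (fun _ => True) =
      LinearMap.id + cone x (fun _ => True) ∘ₗ boundary α from LinearMap.congr_fun h c
  refine Finsupp.lhom_ext' fun σ => LinearMap.ext_ring ?_
  simp only [LinearMap.comp_apply, LinearMap.add_apply, LinearMap.id_apply, Finsupp.lsingle_apply,
    boundary_single, map_sum, cone_single, true_and]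
  by_cases hxσ : x ∈ σ
  · rw [if_neg (fun h => h hxσ), map_zero, Finset.sum_eq_single x, if_pos (Finset.notMem_erase _ _),
      Finset.insert_erase hxσ, ZModModule.add_self]
    · intro v hv hvx
      rw [if_neg]
      exact fun h => h (Finset.mem_erase.2 ⟨hvx.symm, hxσ⟩)
    · exact fun h => (h hxσ).elim
  · rw [if_pos hxσ, boundary_single, Finset.sum_insert hxσ, Finset.erase_insert hxσ]
    congr 1
    refine Finset.sum_congr rfl fun v hv => ?_
    rw [if_pos (fun h => hxσ (Finset.mem_of_mem_erase h)),
      Finset.erase_insert_of_ne (by rintro rfl; exact hxσ hv)]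

/-- The projection of a chain to the link of `v`. -/
noncomputable def toLink (v : α) : (Finset α →₀ ZMod 2) →ₗ[ZMod 2] (Finset α →₀ ZMod 2) :=
  Finsupp.linearCombination (ZMod 2) fun σ => if v ∈ σ then Finsupp.single (σ.erase v) 1 else 0

theorem toLink_single (v : α) (σ : Finset α) :
    toLink v (Finsupp.single σ 1) = if v ∈ σ then Finsupp.single (σ.erase v) 1 else 0 := by
  simp [toLink]

theorem boundary_toLink (v : α) (c : Finset α →₀ ZMod 2) :
    boundary α (toLink v c) = toLink v (boundary α c) := by
  suffices h : boundary α ∘ₗ toLink v = toLink v ∘ₗ boundary α from LinearMap.congr_fun h c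
  refine Finsupp.lhom_ext' fun σ => LinearMap.ext_ring ?_
  simp only [LinearMap.comp_apply, Finsupp.lsingle_apply, boundary_single, map_sum, toLink_single]
  by_cases hv : v ∈ σ
  · rw [if_pos hv, boundary_single, ← Finset.add_sum_erase σ _ hv,
      if_neg (Finset.notMem_erase _ _), zero_add]
    refine Finset.sum_congr rfl fun u hu => ?_
    rw [if_pos (Finset.mem_erase.2 ⟨(Finset.ne_of_mem_erase hu).symm, hv⟩),
      Finset.erase_right_comm]
  · rw [if_neg hv, map_zero, Finset.sum_eq_zero]
    intro u hu
    rw [if_neg (fun h => hv (Finset.mem_of_mem_erase h))]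

/-- If the deletion of `v` is a cone, then the homology of `K` is the homology of the link of `v`
one dimension lower. -/
theorem betti_eq_betti_link {K : LowerSet (Finset α)} {v x : α} (hvx : x ≠ v)
    (hx : ∀ σ ∈ K, v ∉ σ → insert x σ ∈ K) (i : ℤ) :
    betti K i = betti (link K v) (i - 1) := by
  let D : LowerSet (Finset α) :=
    ⟨{σ | v ∉ σ ∧ σ ∈ K}, fun _ _ hle hσ => ⟨fun h => hσ.1 (hle h), K.lower hle hσ.2⟩⟩
  have hDK : D ≤ K := fun σ hσ => hσ.2
  have hlD : link K v ≤ D := fun σ hσ => ⟨hσ.1, K.lower (Finset.subset_insert _ _) hσ.2⟩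
  have hconeD : ∀ {j : ℤ} {z}, z ∈ chains D j → cone x (fun _ => True) z ∈ chains D (j + 1) := by
    intro j z hz
    refine map_chains_le _ _ (fun σ hσ hc => ?_) hz
    rw [cone_single]
    split_ifs with h
    · refine single_mem_chains ⟨?_, hx σ hσ.2 hσ.1⟩ ?_
      · rw [Finset.mem_insert]
        rintro (h | h)
        exacts [hvx h.symm, hσ.1 h]
      · rw [Finset.card_insert_of_notMem h.2]
        push_cast
        omega
    · exact zero_mem _
  have hconeL : ∀ {j : ℤ} {z}, z ∈ chains (link K v) j → cone v (fun _ => True) z ∈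
      chains K (j + 1) := by
    intro j z hz
    refine map_chains_le _ _ (fun σ hσ hc => ?_) hz
    rw [cone_single, if_pos ⟨trivial, hσ.1⟩]
    refine single_mem_chains hσ.2 ?_
    rw [Finset.card_insert_of_notMem hσ.1]
    push_cast
    omega
  have hto : ∀ {j : ℤ} {z}, z ∈ chains K j → toLink v z ∈ chains (link K v) (j - 1) := by
    intro j z hz
    refine map_chains_le _ _ (fun σ hσ hc => ?_) hz
    rw [toLink_single]
    split_ifs with h
    · refine single_mem_chains ⟨Finset.notMem_erase _ _, by rwa [Finset.insert_erase h]⟩ ?_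
      have := Finset.card_erase_add_one h
      omega
    · exact zero_mem _
  have htocone : ∀ {j : ℤ} {z}, z ∈ chains (link K v) j →
      toLink v (cone v (fun _ => True) z) = z := by
    intro j z hz
    refine sub_eq_zero.1 ((Submodule.mem_bot (ZMod 2)).1 (map_chains_le
      (toLink v ∘ₗ cone v (fun _ => True) - LinearMap.id) ⊥ (fun σ hσ hc => ?_) hz))
    rw [LinearMap.sub_apply, LinearMap.comp_apply, cone_single, if_pos ⟨trivial, hσ.1⟩,
      toLink_single, if_pos (Finset.mem_insert_self _ _), Finset.erase_insert hσ.1,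
      LinearMap.id_apply, sub_self]
    exact zero_mem _
  have htoD : ∀ {j : ℤ} {z}, z ∈ chains D j → toLink v z = 0 := by
    intro j z hz
    refine (Submodule.mem_bot (ZMod 2)).1 (map_chains_le _ ⊥ (fun σ hσ hc => ?_) hz)
    rw [toLink_single, if_neg hσ.1]
    exact zero_mem _
  have hkerD : ∀ {j : ℤ} {z}, z ∈ chains K j → toLink v z = 0 → z ∈ chains D j := by
    intro j z hz h0
    have : (LinearMap.id + cone v (fun _ => True) ∘ₗ toLink v :
        (Finset α →₀ ZMod 2) →ₗ[ZMod 2] (Finset α →₀ ZMod 2)) z ∈ chains D j := by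
      refine map_chains_le _ _ (fun σ hσ hc => ?_) hz
      rw [LinearMap.add_apply, LinearMap.comp_apply, toLink_single, LinearMap.id_apply]
      split_ifs with h
      · rw [cone_single, if_pos ⟨trivial, Finset.notMem_erase _ _⟩, Finset.insert_erase h,
          ZModModule.add_self]
        exact zero_mem _
      · rw [map_zero, add_zero]
        exact single_mem_chains ⟨h, hσ⟩ hc
    rwa [LinearMap.add_apply, LinearMap.comp_apply, h0, map_zero, add_zero] at this
  refine betti_eq_of_map (toLink v) ?_ ?_ ?_ ?_
  · intro z hz
    refine ⟨hto hz.1, ?_⟩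
    have h0 : boundary α z = 0 := hz.2
    change boundary α _ = 0
    rw [boundary_toLink, h0, map_zero]
  · rintro _ ⟨c, hc, rfl⟩
    refine ⟨toLink v c, ?_, boundary_toLink _ _⟩
    have := hto hc
    rwa [add_sub_right_comm] at this
  · intro y hy
    have h0 : boundary α y = 0 := hy.2
    have hyD := chains_mono hlD _ hy.1
    -- The suspension of `y` with poles `v` and `x`; its projection to the link of `v` is `y`, since
    -- the second summand avoids `v`.
    refine ⟨cone v (fun _ => True) y + cone x (fun _ => True) y, ⟨add_mem ?_ ?_, ?_⟩, ?_⟩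
    · simpa using hconeL hy.1
    · simpa using chains_mono hDK _ (hconeD hyD)
    · change boundary α _ = 0
      rw [map_add, boundary_cone, boundary_cone, h0, map_zero, map_zero,
        add_zero, ZModModule.add_self]
    · rw [map_add, htocone hy.1, htoD (hconeD hyD), add_zero, sub_self]
      exact zero_mem _
  · rintro z hz ⟨w, hw, hwz⟩
    rw [sub_add_cancel] at hw
    have h0 : boundary α z = 0 := hz.2
    have hwK := hconeL hw
    -- Subtracting the boundary of the cone over `w` moves `z` into the deletion of `v`, where every
    -- cycle bounds its cone with apex `x`.
    have h1 : z + boundary α (cone v (fun _ => True) w) ∈ chains D i := by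
      refine hkerD (add_mem hz.1 (boundary_mem_chains hwK)) ?_
      rw [map_add, ← boundary_toLink, htocone hw, hwz, ZModModule.add_self]
    have h2 := boundary_cone x (z + boundary α (cone v (fun _ => True) w))
    rw [map_add (boundary α), boundary_boundary, h0, add_zero, map_zero, add_zero] at h2
    refine ⟨cone x (fun _ => True) (z + boundary α (cone v (fun _ => True) w)) +
      cone v (fun _ => True) w, add_mem (chains_mono hDK _ (hconeD h1)) hwK, ?_⟩
    rw [map_add, h2, add_assoc, ZModModule.add_self, add_zero]

/-- Homology does not depend on the names of the vertices. -/
theorem betti_eq_of_embedding (f : α ↪ β) {K : LowerSet (Finset α)} {L : LowerSet (Finset β)}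
    (h1 : ∀ σ, σ.map f ∈ L ↔ σ ∈ K) (h2 : ∀ τ ∈ L, ∃ σ : Finset α, σ.map f = τ) (i : ℤ) :
    betti K i = betti L i := by
  let F := Finsupp.lmapDomain (ZMod 2) (ZMod 2) (fun σ : Finset α => σ.map f)
  have hF : ∀ σ, F (Finsupp.single σ 1) = Finsupp.single (σ.map f) 1 := fun σ =>
    Finsupp.mapDomain_single
  have hinj : Function.Injective F :=
    Finsupp.mapDomain_injective (Finset.map_injective f)
  have hcomm : ∀ c, boundary β (F c) = F (boundary α c) := by
    intro c
    suffices h : boundary β ∘ₗ F = F ∘ₗ boundary α from LinearMap.congr_fun h c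
    refine Finsupp.lhom_ext' fun σ => LinearMap.ext_ring ?_
    simp only [LinearMap.comp_apply, Finsupp.lsingle_apply, boundary_single, map_sum, hF,
      Finset.sum_map, Finset.map_erase]
  have hch : ∀ {j : ℤ} {c}, c ∈ chains K j → F c ∈ chains L j := by
    intro j c hc
    refine map_chains_le _ _ (fun σ hσ hcard => ?_) hc
    rw [hF]
    exact single_mem_chains ((h1 σ).2 hσ) (by rwa [Finset.card_map])
  have hsurj : ∀ {j : ℤ} {c}, c ∈ chains L j → c ∈ (chains K j).map F := by
    intro j c hc
    refine map_chains_le LinearMap.id _ (fun τ hτ hcard => ?_) hc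
    obtain ⟨σ, rfl⟩ := h2 τ hτ
    exact ⟨_, single_mem_chains ((h1 σ).1 hτ) (by rwa [Finset.card_map] at hcard), hF σ⟩
  refine betti_eq_of_map F ?_ ?_ ?_ ?_
  · intro z hz
    have h0 : boundary α z = 0 := hz.2
    exact ⟨hch hz.1, (hcomm z).trans (by rw [h0, map_zero])⟩
  · rintro _ ⟨c, hc, rfl⟩
    exact ⟨F c, hch hc, hcomm c⟩
  · intro y hy
    obtain ⟨z, hz, rfl⟩ := hsurj hy.1
    have h0 : boundary β (F z) = 0 := hy.2
    rw [hcomm] at h0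
    refine ⟨z, ⟨hz, hinj (h0.trans (map_zero F).symm)⟩, ?_⟩
    rw [sub_self]
    exact zero_mem _
  · rintro z hz ⟨w, hw, hwz⟩
    obtain ⟨c, hc, rfl⟩ := hsurj hw
    rw [hcomm] at hwz
    exact ⟨c, hc, hinj hwz⟩

theorem betti_eq_zero_of_cycles_le {K : LowerSet (Finset α)} {i : ℤ}
    (h : cycles K i ≤ boundaries K i) : betti K i = 0 := by
  have : Subsingleton (homology K i) :=
    Submodule.Quotient.subsingleton_iff.2 (Submodule.comap_subtype_eq_top.2 h)
  exact Module.finrank_zero_of_subsingleton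

theorem betti_eq_zero_of_chains_eq_bot {K : LowerSet (Finset α)} {i : ℤ}
    (h : chains K i = ⊥) : betti K i = 0 :=
  betti_eq_zero_of_cycles_le fun z hz => by
    have : z = 0 := by simpa [h] using hz.1
    rw [this]
    exact zero_mem _

/-- A cone has no reduced homology. -/
theorem betti_eq_zero_of_cone {K : LowerSet (Finset α)} (x : α) (hx : ∀ σ ∈ K, insert x σ ∈ K)
    (i : ℤ) : betti K i = 0 := by
  -- Every face, including `∅`, is matched by toggling `x`, so even the void complex may serve as
  -- the subcomplex.
  rw [← betti_eq_of_toggle (bot_le : ⊥ ≤ K) x (fun σ hσ _ => ⟨hx σ hσ, LowerSet.notMem_bot⟩)]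
  exact betti_eq_zero_of_chains_eq_bot (chains_eq_bot fun σ hσ => (LowerSet.notMem_bot hσ).elim)

theorem betti_eq_finrank_cycles {K : LowerSet (Finset α)} {i : ℤ} (h : chains K (i + 1) = ⊥) :
    betti K i = Module.finrank (ZMod 2) (cycles K i) := by
  have : (boundaries K i).comap (cycles K i).subtype = ⊥ := by
    rw [boundaries, h, Submodule.map_bot, Submodule.comap_bot, Submodule.ker_subtype]
  exact (Submodule.quotEquivOfEqBot _ this).finrank_eq

/-- The homology of the complex whose only face is `∅`. -/
theorem betti_empty {K : LowerSet (Finset α)} (hK : ∀ σ, σ ∈ K ↔ σ = ∅) (i : ℤ) :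
    betti K i = if i = -1 then 1 else 0 := by
  split_ifs with hi
  · subst hi
    rw [betti_eq_finrank_cycles (chains_eq_bot fun σ hσ => by simp [(hK σ).1 hσ])]
    have : cycles K (-1) = Submodule.span (ZMod 2) {Finsupp.single (∅ : Finset α) (1 : ZMod 2)} := by
      apply le_antisymm
      · intro z hz
        refine map_chains_le LinearMap.id _ (fun σ hσ _ => ?_) hz.1
        rw [(hK σ).1 hσ]
        exact Submodule.mem_span_singleton_self _
      · rw [Submodule.span_singleton_le_iff_mem]
        exact ⟨single_mem_chains ((hK _).2 rfl) (by simp), by simp [boundary_single]⟩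
    rw [this, finrank_span_singleton (by simp)]
  · refine betti_eq_zero_of_chains_eq_bot (chains_eq_bot fun σ hσ => ?_)
    rw [(hK σ).1 hσ]
    simp only [Finset.card_empty]
    omega

/-- The homology of the codimension two skeleton of a simplex with `k + 1` vertices. -/
theorem betti_skeleton {k : ℕ} (hk : 0 < k) {S : Finset α} (hS : S.card = k + 1)
    {K : LowerSet (Finset α)} (hK : ∀ σ, σ ∈ K ↔ σ ⊆ S ∧ σ.card < k) (i : ℤ) :
    betti K i = if i = (k : ℤ) - 2 then k else 0 := by
  let Δ : LowerSet (Finset α) := LowerSet.Iic S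
  have hΔ : ∀ {σ}, σ ∈ Δ ↔ σ ⊆ S := Iff.rfl
  obtain ⟨x, hx⟩ : S.Nonempty := Finset.card_pos.1 (by omega)
  have hch : ∀ {j : ℤ}, j + 1 < k → chains K j = chains Δ j := by
    intro j hj
    unfold chains
    congr 1
    ext σ
    simp only [Set.mem_ofPred_eq, hK, hΔ]
    constructor
    · exact fun h => ⟨h.1.1, h.2⟩
    · exact fun h => ⟨⟨h.1, by omega⟩, h.2⟩
  have hacyc : ∀ j : ℤ, cycles Δ j = boundaries Δ j := by
    intro j
    refine le_antisymm (fun z hz => ?_) (boundaries_le_cycles _ _)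
    have h0 : boundary α z = 0 := hz.2
    refine ⟨cone x (fun _ => True) z, map_chains_le _ _ (fun σ hσ hc => ?_) hz.1, ?_⟩
    · rw [cone_single]
      split_ifs with h
      · refine single_mem_chains (Finset.insert_subset hx hσ) ?_
        rw [Finset.card_insert_of_notMem h.2]
        push_cast
        omega
      · exact zero_mem _
    · rw [boundary_cone, h0, map_zero, add_zero]
  split_ifs with hi
  · rw [betti_eq_finrank_cycles (chains_eq_bot fun σ hσ => by have := ((hK σ).1 hσ).2; omega)]
    -- In the top degree `k - 2` the skeleton has the cycles of the full simplex, and these are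
    -- boundaries because the simplex is acyclic.
    have hcyc : cycles K i = boundaries Δ i := by
      rw [← hacyc, cycles, cycles, hch (by omega)]
    rw [hcyc]
    have hfin : ∀ j : ℤ, Module.Finite (ZMod 2) (chains Δ j) := by
      intro j
      have : {σ : Finset α | σ ∈ Δ ∧ (σ.card : ℤ) = j + 1}.Finite :=
        (Finset.finite_toSet S.powerset).subset fun σ h => by simpa using hΔ.1 h.1
      have := this.to_subtype
      exact Module.Finite.equiv (Finsupp.supportedEquivFinsupp
        (M := ZMod 2) (R := ZMod 2) {σ : Finset α | σ ∈ Δ ∧ (σ.card : ℤ) = j + 1}).symm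
    have hdim : ∀ j : ℕ, Module.finrank (ZMod 2) (chains Δ ((j : ℤ) - 1)) = (k + 1).choose j := by
      intro j
      have hset : {σ : Finset α | σ ∈ Δ ∧ (σ.card : ℤ) = (j : ℤ) - 1 + 1} =
          (S.powersetCard j : Set (Finset α)) := by
        ext σ
        simp only [Set.mem_ofPred_eq, hΔ, Finset.mem_coe, Finset.mem_powersetCard]
        constructor <;> rintro ⟨h, h'⟩ <;> exact ⟨h, by omega⟩
      rw [chains, hset, (Finsupp.supportedEquivFinsupp _).finrank_eq, Module.finrank_finsupp_self]
      simp [hS]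
    have hrank : ∀ j : ℤ, Module.finrank (ZMod 2) (boundaries Δ j) +
        Module.finrank (ZMod 2) (boundaries Δ (j + 1)) =
        Module.finrank (ZMod 2) (chains Δ (j + 1)) := by
      intro j
      have := hfin (j + 1)
      rw [← hacyc (j + 1)]
      exact finrank_map_add_finrank_inf_ker (boundary α) (chains Δ (j + 1))
    have hbot : boundaries Δ (k : ℤ) = ⊥ := by
      rw [boundaries, chains_eq_bot, Submodule.map_bot]
      intro σ hσ
      have := Finset.card_le_card (hΔ.1 hσ)
      omega
    -- Rank count: the boundaries in degrees `k - 2` and `k - 1` have ranks adding up to `k + 1`,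
    -- and the latter rank is `1`, coming from the single top face; this leaves `k`.
    have h1 := hrank ((k : ℤ) - 2)
    have h2 := hrank ((k : ℤ) - 1)
    have h3 := hdim k
    have h4 := hdim (k + 1)
    rw [show (k : ℤ) - 2 + 1 = k - 1 by ring] at h1
    rw [show (k : ℤ) - 1 + 1 = k by ring, hbot, finrank_bot] at h2
    rw [show ((k + 1 : ℕ) : ℤ) - 1 = k by push_cast; ring, Nat.choose_self] at h4
    rw [Nat.choose_succ_self_right] at h3
    rw [hi]
    omega
  · by_cases hlt : i + 1 < (k : ℤ) - 1
    · refine betti_eq_zero_of_cycles_le ?_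
      rw [cycles, boundaries, hch (by omega), hch (by omega)]
      exact (hacyc i).le
    · refine betti_eq_zero_of_chains_eq_bot (chains_eq_bot fun σ hσ => ?_)
      have := ((hK σ).1 hσ).2
      omega

end Tools

/-! ### Changing edges while preserving homology; joins. -/

section Independence

/-- The finite sets of natural numbers that contain no member of `E`. -/
def indep (E : Set (Finset ℕ)) : LowerSet (Finset ℕ) where
  carrier := {W | ∀ e ∈ E, ¬ e ⊆ W}
  lower' := fun _ _ hle hW e he h => hW e he (h.trans hle)

theorem indep_anti {E F : Set (Finset ℕ)} (h : E ⊆ F) : indep F ≤ indep E :=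
  fun _ hW e he => hW e (h he)

/-- `indep E` is contained in `indep F` if every member of `F` contains a member of `E`. -/
theorem indep_le {E F : Set (Finset ℕ)} (h : ∀ f ∈ F, ∃ e ∈ E, e ⊆ f) : indep E ≤ indep F := by
  intro W hW f hf hfW
  obtain ⟨e, he, hef⟩ := h f hf
  exact hW e he (hef.trans hfW)

/-- An edge may be added if its link is a cone with apex `x`. -/
theorem betti_indep_insert {E : Set (Finset ℕ)} {e : Finset ℕ} (x : ℕ) (hxe : x ∉ e)
    (h : ∀ f ∈ E, x ∈ f → ∃ g ∈ E, x ∉ g ∧ g ⊆ f ∪ e) (i : ℤ) :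
    betti (indep (insert e E)) i = betti (indep E) i := by
  refine betti_eq_of_toggle (indep_anti (Set.subset_insert _ _)) x (fun σ hσ hσe => ?_) i
  have he : e ⊆ σ := by
    by_contra hn
    refine hσe fun f hf => ?_
    rcases hf with rfl | hf
    exacts [hn, hσ f hf]
  refine ⟨fun f hf hfσ => ?_, fun hn => hn e (Set.mem_insert _ _) ?_⟩
  -- As `e ⊆ σ`, an edge `f ⊆ insert x σ` through `x` would yield an edge `g ⊆ insert x σ` avoiding
  -- `x`, hence inside the face `σ`.
  · by_cases hxf : x ∈ f
    · obtain ⟨g, hg, hxg, hgf⟩ := h f hf hxf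
      refine hσ g hg fun y hy => ?_
      rcases Finset.mem_union.1 (hgf hy) with h1 | h1
      · rcases Finset.mem_insert.1 (hfσ h1) with rfl | h2
        exacts [(hxg hy).elim, h2]
      · exact he h1
    · exact hσ f hf ((Finset.subset_insert_iff_of_notMem hxf).1 hfσ)
  · exact fun y hy => Finset.mem_erase.2 ⟨fun h => hxe (h ▸ hy), he hy⟩

/-- The edges of `F` are inserted one at a time. Edges through `x` are tested in all of `E ∪ F`,
since earlier insertions may contain `x`, while the witness `g` must lie in `E`; hence any order
works. -/
theorem betti_indep_union {E F : Set (Finset ℕ)} (hF : F.Finite)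
    (h : ∀ e ∈ F, ∃ x ∉ e, ∀ f ∈ E ∪ F, x ∈ f → ∃ g ∈ E, x ∉ g ∧ g ⊆ f ∪ e) (i : ℤ) :
    betti (indep (E ∪ F)) i = betti (indep E) i := by
  suffices H : ∀ F' : Set (Finset ℕ), F'.Finite → F' ⊆ F →
      betti (indep (E ∪ F')) i = betti (indep E) i from H F hF subset_rfl
  intro F' hF'
  induction F', hF' using Set.Finite.induction_on with
  | empty => intro; rw [Set.union_empty]
  | @insert e F' _ _ ih =>
    intro hsub
    rw [Set.insert_subset_iff] at hsub
    obtain ⟨x, hxe, hx⟩ := h e hsub.1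
    rw [Set.union_insert, betti_indep_insert x hxe, ih hsub.2]
    intro f hf hxf
    obtain ⟨g, hg, hg'⟩ := hx f (Set.union_subset_union_right _ hsub.2 hf) hxf
    exact ⟨g, Or.inl hg, hg'⟩

/-- The edges that exclude all vertices from `n` on. -/
def beyond (n : ℕ) : Set (Finset ℕ) := {e | ∃ j, n ≤ j ∧ e = {j}}

/-- The edges of the tight path on `0, …, n - 1`. -/
def intervals (n k : ℕ) : Set (Finset ℕ) := {e | ∃ s, s + k ≤ n ∧ e = Finset.Ico s (s + k)}

/-- The edges of the tight cycle on `0, …, n - 1` that run over the point between `n - 1` and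
`0`. -/
def wraps (n k : ℕ) : Set (Finset ℕ) :=
  {e | ∃ a, 1 ≤ a ∧ a < k ∧ e = Finset.Ico (n + a - k) n ∪ Finset.range a}

/-- The join with the boundary of a simplex is an iterated suspension. -/
theorem betti_indep_join_simplex {G : Set (Finset ℕ)} {m : ℕ} (hG : ∀ g ∈ G, g ⊆ Finset.range m)
    (k : ℕ) (i : ℤ) :
    betti (indep (G ∪ {Finset.Ico m (m + (k + 1))} ∪ beyond (m + (k + 1)))) i =
      betti (indep (G ∪ beyond m)) (i - k) := by
  induction k generalizing i with
  | zero =>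
    -- The boundary of a single vertex is `{∅}`: the edge `{m}` merely excludes `m`.
    have : indep (G ∪ {Finset.Ico m (m + (0 + 1))} ∪ beyond (m + (0 + 1))) =
        indep (G ∪ beyond m) := by
      apply le_antisymm <;> apply indep_le
      · rintro f (hf | ⟨j, hj, rfl⟩)
        · exact ⟨f, Or.inl (Or.inl hf), subset_rfl⟩
        · rcases eq_or_lt_of_le hj with rfl | hj
          · exact ⟨_, Or.inl (Or.inr rfl), by simp⟩
          · exact ⟨_, Or.inr ⟨j, by omega, rfl⟩, subset_rfl⟩
      · rintro f ((hf | rfl) | ⟨j, hj, rfl⟩)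
        · exact ⟨f, Or.inl hf, subset_rfl⟩
        · exact ⟨{m}, Or.inr ⟨m, le_rfl, rfl⟩, by simp⟩
        · exact ⟨_, Or.inr ⟨j, by omega, rfl⟩, subset_rfl⟩
    rw [this, Nat.cast_zero, sub_zero]
  | succ k ih =>
    -- Without the last vertex of the block, the block edge imposes nothing, so the deletion is a
    -- cone over `m`; the link has a block one vertex shorter.
    rw [betti_eq_betti_link (v := m + (k + 1)) (x := m) (by omega)]
    · have : link (indep (G ∪ {Finset.Ico m (m + (k + 1 + 1))} ∪ beyond (m + (k + 1 + 1))))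
          (m + (k + 1)) = indep (G ∪ {Finset.Ico m (m + (k + 1))} ∪ beyond (m + (k + 1))) := by
        ext W
        constructor
        · rintro ⟨hv, hW⟩ f ((hf | rfl) | ⟨j, hj, rfl⟩) hfW
          · exact hW f (Or.inl (Or.inl hf)) (hfW.trans (Finset.subset_insert _ _))
          · refine hW _ (Or.inl (Or.inr rfl)) fun y hy => ?_
            rw [Finset.mem_Ico] at hy
            rw [Finset.mem_insert]
            by_cases h : y = m + (k + 1)
            · exact Or.inl h
            · exact Or.inr (hfW (Finset.mem_Ico.2 (by omega)))
          · rcases eq_or_lt_of_le hj with rfl | hj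
            · exact hv (hfW (Finset.mem_singleton_self _))
            · exact hW {j} (Or.inr ⟨j, by omega, rfl⟩) (hfW.trans (Finset.subset_insert _ _))
        · intro hW
          have hv : m + (k + 1) ∉ W := fun h => hW {m + (k + 1)} (Or.inr ⟨_, le_rfl, rfl⟩)
            (Finset.singleton_subset_iff.2 h)
          refine ⟨hv, ?_⟩
          rintro f ((hf | rfl) | ⟨j, hj, rfl⟩) hfW
          · refine hW f (Or.inl (Or.inl hf)) ((Finset.subset_insert_iff_of_notMem ?_).1 hfW)
            intro h
            have := Finset.mem_range.1 (hG f hf h)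
            omega
          · refine hW _ (Or.inl (Or.inr rfl)) fun y hy => ?_
            rw [Finset.mem_Ico] at hy
            rcases Finset.mem_insert.1 (hfW (Finset.mem_Ico.2
              (show m ≤ y ∧ y < m + (k + 1 + 1) by omega))) with h | h
            · omega
            · exact h
          · refine hW {j} (Or.inr ⟨j, by omega, rfl⟩)
              ((Finset.subset_insert_iff_of_notMem ?_).1 hfW)
            rw [Finset.mem_singleton]
            omega
      rw [this, ih]
      congr 1
      push_cast
      ring
    · rintro W hW hv f ((hf | rfl) | ⟨j, hj, rfl⟩) hfW
      · refine hW f (Or.inl (Or.inl hf)) ((Finset.subset_insert_iff_of_notMem ?_).1 hfW)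
        intro h
        have := Finset.mem_range.1 (hG f hf h)
        omega
      · rcases Finset.mem_insert.1 (hfW (Finset.mem_Ico.2
          (show m ≤ m + (k + 1) ∧ m + (k + 1) < m + (k + 1 + 1) by omega))) with h | h
        · omega
        · exact hv h
      · refine hW {j} (Or.inr ⟨j, by omega, rfl⟩)
          ((Finset.subset_insert_iff_of_notMem ?_).1 hfW)
        rw [Finset.mem_singleton]
        omega

/-- The join with the independence complex of a tight path on `k + 1` vertices is an iterated
suspension. -/
theorem betti_indep_join_path {G : Set (Finset ℕ)} {m k : ℕ} (hk : 0 < k)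
    (hG : ∀ g ∈ G, g ⊆ Finset.range m) (i : ℤ) :
    betti (indep (G ∪ {Finset.Ico m (m + k), Finset.Ico (m + 1) (m + 1 + k)} ∪
      beyond (m + k + 1))) i = betti (indep (G ∪ beyond m)) (i - (k - 1)) := by
  obtain ⟨k, rfl⟩ : ∃ l, k = l + 1 := ⟨k - 1, by omega⟩
  -- Exclude the last vertex, with apex `m`: the only edge through `m` is the first of the two, and
  -- together with the last vertex it contains the second. A simplex boundary on the other block
  -- vertices remains.
  rw [← betti_indep_insert (e := {m + (k + 1)}) m (by simp)]
  · have : indep (insert {m + (k + 1)} (G ∪ {Finset.Ico m (m + (k + 1)),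
        Finset.Ico (m + 1) (m + 1 + (k + 1))} ∪ beyond (m + (k + 1) + 1))) =
        indep (G ∪ {Finset.Ico m (m + (k + 1))} ∪ beyond (m + (k + 1))) := by
      apply le_antisymm <;> apply indep_le
      · rintro f ((hf | rfl) | ⟨j, hj, rfl⟩)
        · exact ⟨f, Or.inr (Or.inl (Or.inl hf)), subset_rfl⟩
        · exact ⟨_, Or.inr (Or.inl (Or.inr (Or.inl rfl))), subset_rfl⟩
        · rcases eq_or_lt_of_le hj with rfl | hj
          · exact ⟨_, Or.inl rfl, subset_rfl⟩
          · exact ⟨_, Or.inr (Or.inr ⟨j, by omega, rfl⟩), subset_rfl⟩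
      · rintro f (rfl | ((hf | rfl | rfl) | ⟨j, hj, rfl⟩))
        · exact ⟨_, Or.inr ⟨_, le_rfl, rfl⟩, subset_rfl⟩
        · exact ⟨f, Or.inl (Or.inl hf), subset_rfl⟩
        · exact ⟨_, Or.inl (Or.inr rfl), subset_rfl⟩
        · refine ⟨{m + (k + 1)}, Or.inr ⟨_, le_rfl, rfl⟩, ?_⟩
          rw [Finset.singleton_subset_iff, Finset.mem_Ico]
          omega
        · exact ⟨_, Or.inr ⟨j, by omega, rfl⟩, subset_rfl⟩
    rw [this, betti_indep_join_simplex hG]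
    congr 1
    push_cast
    ring
  · rintro f ((hf | rfl | rfl) | ⟨j, hj, rfl⟩) hm
    · exact absurd (Finset.mem_range.1 (hG f hf hm)) (lt_irrefl _)
    · refine ⟨Finset.Ico (m + 1) (m + 1 + (k + 1)), Or.inl (Or.inr (Or.inr rfl)), ?_, ?_⟩
      · simp
      · intro y
        simp only [Finset.mem_Ico, Finset.mem_union, Finset.mem_singleton]
        omega
    · simp at hm
    · rw [Finset.mem_singleton] at hm
      omega

/-! ### Recursion for paths and cycles, removing `k + 1` vertices. -/

theorem finite_of_subset_range {F : Set (Finset ℕ)} (n : ℕ) (h : ∀ e ∈ F, e ⊆ Finset.range n) :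
    F.Finite :=
  (Finset.finite_toSet (Finset.range n).powerset).subset fun e he =>
    Finset.mem_coe.2 (Finset.mem_powerset.2 (h e he))

/-- The family `F` in the proof consists of the edges crossing between the first `m` and the last `k
+ 1` vertices; without them the hypergraph is a disjoint union and its complex a join. -/
theorem betti_path_step {k : ℕ} (hk : 0 < k) (m : ℕ) (i : ℤ) :
    betti (indep (intervals (m + k + 1) k ∪ beyond (m + k + 1))) i =
      betti (indep (intervals m k ∪ beyond m)) (i - (k - 1)) := by
  have hG : ∀ g ∈ intervals m k, g ⊆ Finset.range m := by
    rintro _ ⟨s, hs, rfl⟩ y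
    simp only [Finset.mem_Ico, Finset.mem_range]
    omega
  rw [← betti_indep_join_path hk hG]
  rw [← betti_indep_union (E := intervals m k ∪ {Finset.Ico m (m + k), Finset.Ico (m + 1) (m + 1 + k)}
    ∪ beyond (m + k + 1)) (F := {e | ∃ s, s < m ∧ m < s + k ∧ e = Finset.Ico s (s + k)})]
  · congr 2
    ext f
    constructor
    · rintro (⟨s, hs, rfl⟩ | hf)
      · by_cases h1 : s + k ≤ m
        · exact Or.inl (Or.inl (Or.inl ⟨s, h1, rfl⟩))
        by_cases h2 : s < m
        · exact Or.inr ⟨s, h2, by omega, rfl⟩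
        obtain rfl | rfl : s = m ∨ s = m + 1 := by omega
        · exact Or.inl (Or.inl (Or.inr (Or.inl rfl)))
        · exact Or.inl (Or.inl (Or.inr (Or.inr rfl)))
      · exact Or.inl (Or.inr hf)
    · rintro (((⟨s, hs, rfl⟩ | rfl | rfl) | hf) | ⟨s, hs, _, rfl⟩)
      · exact Or.inl ⟨s, by omega, rfl⟩
      · exact Or.inl ⟨m, by omega, rfl⟩
      · exact Or.inl ⟨m + 1, by omega, rfl⟩
      · exact Or.inr hf
      · exact Or.inl ⟨s, by omega, rfl⟩
  · apply finite_of_subset_range (m + k)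
    rintro _ ⟨s, hs, _, rfl⟩ y
    simp only [Finset.mem_Ico, Finset.mem_range]
    omega
  · rintro _ ⟨s, hs, hs', rfl⟩
    -- The only edge through the last vertex `m + k` is the last one; a crossing edge supplies the
    -- missing `m`, so the union contains the first edge of the block.
    refine ⟨m + k, by simp; omega, ?_⟩
    rintro f (((hf | rfl | rfl) | ⟨j, hj, rfl⟩) | ⟨s', hs1, _, rfl⟩) hm
    · have := Finset.mem_range.1 (hG f hf hm)
      omega
    · simp at hm
    · refine ⟨Finset.Ico m (m + k), Or.inl (Or.inr (Or.inl rfl)), by simp, ?_⟩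
      intro y
      simp only [Finset.mem_Ico, Finset.mem_union]
      omega
    · rw [Finset.mem_singleton] at hm
      omega
    · rw [Finset.mem_Ico] at hm
      omega

/-- The long cycle and the join of the short cycle with a path on `k + 1` vertices have no evident
inclusion of edge sets. Both are enlarged to the same set: `hA` adds the short wraps to the long
cycle, `hB` adds the crossing edges and the long wraps to the join. The case `m = k`, where the
short cycle degenerates, is allowed. -/
theorem betti_cycle_step {k : ℕ} (hk : 0 < k) {m : ℕ} (hm : k ≤ m) (i : ℤ) :
    betti (indep (intervals (m + k + 1) k ∪ wraps (m + k + 1) k ∪ beyond (m + k + 1))) i =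
      betti (indep (intervals m k ∪ wraps m k ∪ beyond m)) (i - (k - 1)) := by
  have hw : ∀ g ∈ wraps m k, g ⊆ Finset.range m := by
    rintro _ ⟨a, ha, ha', rfl⟩ y
    simp only [Finset.mem_Ico, Finset.mem_range, Finset.mem_union]
    omega
  have hG : ∀ g ∈ intervals m k ∪ wraps m k, g ⊆ Finset.range m := by
    rintro _ (⟨s, hs, rfl⟩ | hg) y
    · simp only [Finset.mem_Ico, Finset.mem_range]
      omega
    · exact fun h => hw _ hg h
  have hA : betti (indep (intervals (m + k + 1) k ∪ wraps (m + k + 1) k ∪ beyond (m + k + 1) ∪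
      wraps m k)) i =
      betti (indep (intervals (m + k + 1) k ∪ wraps (m + k + 1) k ∪ beyond (m + k + 1))) i := by
    refine betti_indep_union ?_ ?_ i
    · exact finite_of_subset_range m hw
    · rintro _ ⟨a, ha, hak, rfl⟩
      -- The short wrap of parameter `a` ends just before `m` and resumes at `0`. An edge through `m
      -- + a` completes it either to the interval ending just before `m + a` or to the long wrap of
      -- parameter `a`, which starts just after `m + a`.
      refine ⟨m + a, by simp, ?_⟩
      rintro f (((⟨s, hs, rfl⟩ | ⟨b, hb, hbk, rfl⟩) | ⟨j, hj, rfl⟩) | hf) hx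
      · rw [Finset.mem_Ico] at hx
        by_cases h : s ≤ m
        · refine ⟨Finset.Ico (m + a - k) (m + a - k + k),
            Or.inl (Or.inl ⟨_, by omega, rfl⟩), ?_, ?_⟩
          · rw [Finset.mem_Ico]
            omega
          · intro y
            simp only [Finset.mem_Ico, Finset.mem_union, Finset.mem_range]
            omega
        · refine ⟨_, Or.inl (Or.inr ⟨a, ha, hak, rfl⟩), ?_, ?_⟩
          · simp only [Finset.mem_Ico, Finset.mem_union, Finset.mem_range]
            omega
          · intro y
            simp only [Finset.mem_Ico, Finset.mem_union, Finset.mem_range]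
            omega
      · simp only [Finset.mem_Ico, Finset.mem_union, Finset.mem_range] at hx
        refine ⟨_, Or.inl (Or.inr ⟨a, ha, hak, rfl⟩), ?_, ?_⟩
        · simp only [Finset.mem_Ico, Finset.mem_union, Finset.mem_range]
          omega
        · intro y
          simp only [Finset.mem_Ico, Finset.mem_union, Finset.mem_range]
          omega
      · rw [Finset.mem_singleton] at hx
        omega
      · have := Finset.mem_range.1 (hw f hf hx)
        omega
  have hB : betti (indep (intervals m k ∪ wraps m k ∪
      {Finset.Ico m (m + k), Finset.Ico (m + 1) (m + 1 + k)} ∪ beyond (m + k + 1) ∪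
      ({e | ∃ s, s < m ∧ m < s + k ∧ e = Finset.Ico s (s + k)} ∪ wraps (m + k + 1) k))) i =
      betti (indep (intervals m k ∪ wraps m k ∪
      {Finset.Ico m (m + k), Finset.Ico (m + 1) (m + 1 + k)} ∪ beyond (m + k + 1))) i := by
    refine betti_indep_union ?_ ?_ i
    · apply finite_of_subset_range (m + k + 1)
      rintro _ (⟨s, hs, _, rfl⟩ | ⟨a, ha, hak, rfl⟩) y
      · simp only [Finset.mem_Ico, Finset.mem_range]
        omega
      · simp only [Finset.mem_Ico, Finset.mem_range, Finset.mem_union]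
        omega
    -- A crossing edge and a long wrap either contain a short wrap between them or overlap enough to
    -- cover the whole block. This handles their interaction whichever is the edge being added.
    · have key : ∀ s a, s < m → m < s + k → 1 ≤ a → a < k →
          (k ≤ m - s + a ∧ ∃ g ∈ wraps m k, g ⊆ Finset.Ico s (s + k) ∪
            (Finset.Ico (m + k + 1 + a - k) (m + k + 1) ∪ Finset.range a)) ∨
          (Finset.Ico m (m + k + 1) ⊆ Finset.Ico s (s + k) ∪
            (Finset.Ico (m + k + 1 + a - k) (m + k + 1) ∪ Finset.range a)) := by
        intro s a hs hsk ha hak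
        by_cases h : k ≤ m - s + a
        · refine Or.inl ⟨h, _, ⟨s + k - m, by omega, by omega, rfl⟩, ?_⟩
          intro y
          simp only [Finset.mem_Ico, Finset.mem_union, Finset.mem_range]
          omega
        · right
          intro y
          simp only [Finset.mem_Ico, Finset.mem_union, Finset.mem_range]
          omega
      rintro _ (⟨s, hs, hsk, rfl⟩ | ⟨a, ha, hak, rfl⟩)
      · refine ⟨m + k, by simp; omega, ?_⟩
        rintro f (((hf | rfl | rfl) | ⟨j, hj, rfl⟩) | (⟨s', hs1, _, rfl⟩ | ⟨a, ha, hak, rfl⟩)) hx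
        · have := Finset.mem_range.1 (hG f hf hx)
          omega
        · simp at hx
        · refine ⟨Finset.Ico m (m + k), Or.inl (Or.inr (Or.inl rfl)), by simp, ?_⟩
          intro y
          simp only [Finset.mem_Ico, Finset.mem_union]
          omega
        · rw [Finset.mem_singleton] at hx
          omega
        · rw [Finset.mem_Ico] at hx
          omega
        · rw [Finset.union_comm]
          rcases key s a hs hsk ha hak with ⟨_, g, hg, hgs⟩ | h
          · refine ⟨g, Or.inl (Or.inl (Or.inr hg)), fun h => ?_, hgs⟩
            have := Finset.mem_range.1 (hw g hg h)
            omega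
          · refine ⟨Finset.Ico m (m + k), Or.inl (Or.inr (Or.inl rfl)), by simp, ?_⟩
            exact (Finset.Ico_subset_Ico le_rfl (by omega)).trans h
      -- Long wraps contain `m + k` but never `m`, so for them the apex is the opposite end of the
      -- block.
      · refine ⟨m, by simp; omega, ?_⟩
        rintro f (((hf | rfl | rfl) | ⟨j, hj, rfl⟩) | (⟨s, hs, hsk, rfl⟩ | ⟨b, hb, hbk, rfl⟩)) hx
        · exact absurd (Finset.mem_range.1 (hG f hf hx)) (lt_irrefl _)
        · refine ⟨Finset.Ico (m + 1) (m + 1 + k), Or.inl (Or.inr (Or.inr rfl)), by simp, ?_⟩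
          intro y
          simp only [Finset.mem_Ico, Finset.mem_union, Finset.mem_range]
          omega
        · simp at hx
        · rw [Finset.mem_singleton] at hx
          omega
        · rcases key s a hs hsk ha hak with ⟨_, g, hg, hgs⟩ | h
          · refine ⟨g, Or.inl (Or.inl (Or.inr hg)), fun h => ?_, hgs⟩
            exact absurd (Finset.mem_range.1 (hw g hg h)) (lt_irrefl _)
          · refine ⟨Finset.Ico (m + 1) (m + 1 + k), Or.inl (Or.inr (Or.inr rfl)), by simp, ?_⟩
            exact (Finset.Ico_subset_Ico (by omega) (by omega)).trans h
        · simp only [Finset.mem_Ico, Finset.mem_union, Finset.mem_range] at hx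
          omega
  rw [← betti_indep_join_path hk hG, ← hA, ← hB]
  congr 2
  ext f
  constructor
  · rintro (((⟨s, hs, rfl⟩ | hf) | hf) | hf)
    · by_cases h1 : s + k ≤ m
      · exact Or.inl (Or.inl (Or.inl (Or.inl ⟨s, h1, rfl⟩)))
      by_cases h2 : s < m
      · exact Or.inr (Or.inl ⟨s, h2, by omega, rfl⟩)
      obtain rfl | rfl : s = m ∨ s = m + 1 := by omega
      · exact Or.inl (Or.inl (Or.inr (Or.inl rfl)))
      · exact Or.inl (Or.inl (Or.inr (Or.inr rfl)))
    · exact Or.inr (Or.inr hf)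
    · exact Or.inl (Or.inr hf)
    · exact Or.inl (Or.inl (Or.inl (Or.inr hf)))
  · rintro (((((⟨s, hs, rfl⟩ | hf) | rfl | rfl) | hf)) | (⟨s, hs, _, rfl⟩ | hf))
    · exact Or.inl (Or.inl (Or.inl ⟨s, by omega, rfl⟩))
    · exact Or.inr hf
    · exact Or.inl (Or.inl (Or.inl ⟨m, by omega, rfl⟩))
    · exact Or.inl (Or.inl (Or.inl ⟨m + 1, by omega, rfl⟩))
    · exact Or.inl (Or.inr hf)
    · exact Or.inl (Or.inl (Or.inl ⟨s, by omega, rfl⟩))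
    · exact Or.inl (Or.inl (Or.inr hf))

/-! ### Cycles with more than `k + 1` and fewer than `2 * k + 1` vertices. -/

/-- When `m < k` there is no cycle on `m` vertices to reduce to. Instead the edge `range k` is
shortened one vertex at a time until it becomes `range m`, the edge of a simplex boundary. -/
theorem betti_cycle_insert_range {k m : ℕ} (hm : 0 < m) (hmk : m < k) (d : ℕ) (hd : d ≤ k - m)
    (i : ℤ) :
    betti (indep (insert (Finset.range (k - d))
      (intervals (m + k + 1) k ∪ wraps (m + k + 1) k ∪ beyond (m + k + 1)))) i =
    betti (indep (intervals (m + k + 1) k ∪ wraps (m + k + 1) k ∪ beyond (m + k + 1))) i := by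
  induction d with
  | zero =>
    rw [Set.insert_eq_of_mem]
    exact Or.inl (Or.inl ⟨0, by omega, by rw [Nat.sub_zero, zero_add, Finset.range_eq_Ico]⟩)
  | succ d ih =>
    rw [← ih (by omega)]
    obtain ⟨r, hr⟩ : ∃ r, k - d = r + 1 := ⟨k - d - 1, by omega⟩
    rw [show k - (d + 1) = r by omega, hr]
    rw [← betti_indep_insert (E := insert (Finset.range (r + 1))
      (intervals (m + k + 1) k ∪ wraps (m + k + 1) k ∪ beyond (m + k + 1)))
      (e := Finset.range r) (r + 1) (by simp)]
    · congr 1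
      apply le_antisymm <;> apply indep_le
      · rintro f (rfl | rfl | hf)
        · exact ⟨_, Or.inl rfl, subset_rfl⟩
        · exact ⟨_, Or.inl rfl, Finset.range_mono (by omega)⟩
        · exact ⟨f, Or.inr hf, subset_rfl⟩
      · rintro f (rfl | hf)
        · exact ⟨_, Or.inl rfl, subset_rfl⟩
        · exact ⟨f, Or.inr (Or.inr hf), subset_rfl⟩
    · intro f hf hx
      by_cases hrf : r ∈ f
      · refine ⟨_, Or.inl rfl, by simp, ?_⟩
        intro y hy
        rw [Finset.mem_range] at hy
        rw [Finset.mem_union, Finset.mem_range]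
        by_cases h : y = r
        · exact Or.inl (h ▸ hrf)
        · exact Or.inr (by omega)
      -- An edge containing `r + 1` but not `r` starts at `r + 1`, apart from an initial piece in
      -- case of a wrap. Hence it covers the upper part of the wrap of parameter `r`, and `range r`
      -- is the rest. That wrap avoids `r + 1` because `m > 0`.
      · refine ⟨_, Or.inr (Or.inl (Or.inr ⟨r, by omega, by omega, rfl⟩)), ?_, ?_⟩
        · simp only [Finset.mem_Ico, Finset.mem_union, Finset.mem_range]
          omega
        · rcases hf with rfl | ((⟨s, hs, rfl⟩ | ⟨b, hb, hbk, rfl⟩) | ⟨j, hj, rfl⟩)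
          · rw [Finset.mem_range] at hx
            omega
          · intro y
            simp only [Finset.mem_Ico, Finset.mem_union, Finset.mem_range] at hx hrf ⊢
            omega
          · intro y
            simp only [Finset.mem_Ico, Finset.mem_union, Finset.mem_range] at hx hrf ⊢
            omega
          · rw [Finset.mem_singleton] at hx
            omega

/-- Once `range m` is an edge, the interval at `0` and the wraps with parameter at least `m` contain
it and become redundant. The remaining edges outside the block cross its ends and are removed as in
`betti_cycle_step`, with `range m` in the role of the short cycle. -/
theorem betti_short_cycle {k m : ℕ} (hm : 0 < m) (hmk : m < k) (i : ℤ) :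
    betti (indep (intervals (m + k + 1) k ∪ wraps (m + k + 1) k ∪ beyond (m + k + 1))) i =
      betti (indep ({Finset.range m} ∪ beyond m)) (i - (k - 1)) := by
  have hG : ∀ g ∈ ({Finset.range m} : Set (Finset ℕ)), g ⊆ Finset.range m := by
    rintro _ rfl
    exact subset_rfl
  rw [← betti_indep_join_path (by omega : 0 < k) hG,
    ← betti_cycle_insert_range hm hmk (k - m) le_rfl, Nat.sub_sub_self hmk.le]
  rw [← betti_indep_union (E := {Finset.range m} ∪
    {Finset.Ico m (m + k), Finset.Ico (m + 1) (m + 1 + k)} ∪ beyond (m + k + 1))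
    (F := {e | ∃ s, 1 ≤ s ∧ s < m ∧ e = Finset.Ico s (s + k)} ∪
    {e | ∃ a, 1 ≤ a ∧ a < m ∧
      e = Finset.Ico (m + k + 1 + a - k) (m + k + 1) ∪ Finset.range a})]
  · congr 1
    apply le_antisymm <;> apply indep_le
    · rintro f (((rfl | rfl | rfl) | hf) | ⟨s, hs, hsm, rfl⟩ | ⟨a, ha, ham, rfl⟩)
      · exact ⟨_, Or.inl rfl, subset_rfl⟩
      · exact ⟨_, Or.inr (Or.inl (Or.inl ⟨m, by omega, rfl⟩)), subset_rfl⟩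
      · exact ⟨_, Or.inr (Or.inl (Or.inl ⟨m + 1, by omega, rfl⟩)), subset_rfl⟩
      · exact ⟨f, Or.inr (Or.inr hf), subset_rfl⟩
      · exact ⟨_, Or.inr (Or.inl (Or.inl ⟨s, by omega, rfl⟩)), subset_rfl⟩
      · exact ⟨_, Or.inr (Or.inl (Or.inr ⟨a, ha, by omega, rfl⟩)), subset_rfl⟩
    · rintro f (rfl | ((⟨s, hs, rfl⟩ | ⟨a, ha, hak, rfl⟩) | hf))
      · exact ⟨_, Or.inl (Or.inl (Or.inl rfl)), subset_rfl⟩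
      · by_cases h0 : s = 0
        · refine ⟨_, Or.inl (Or.inl (Or.inl rfl)), fun y => ?_⟩
          simp only [Finset.mem_Ico, Finset.mem_range]
          omega
        by_cases h1 : s < m
        · exact ⟨_, Or.inr (Or.inl ⟨s, by omega, h1, rfl⟩), subset_rfl⟩
        obtain rfl | rfl : s = m ∨ s = m + 1 := by omega
        · exact ⟨_, Or.inl (Or.inl (Or.inr (Or.inl rfl))), subset_rfl⟩
        · exact ⟨_, Or.inl (Or.inl (Or.inr (Or.inr rfl))), subset_rfl⟩
      · by_cases h1 : a < m
        · exact ⟨_, Or.inr (Or.inr ⟨a, ha, h1, rfl⟩), subset_rfl⟩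
        · refine ⟨_, Or.inl (Or.inl (Or.inl rfl)), fun y => ?_⟩
          simp only [Finset.mem_Ico, Finset.mem_range, Finset.mem_union]
          omega
      · exact ⟨f, Or.inl (Or.inr hf), subset_rfl⟩
  · apply finite_of_subset_range (m + k + 1)
    rintro _ (⟨s, hs, hsm, rfl⟩ | ⟨a, ha, ham, rfl⟩) y
    · simp only [Finset.mem_Ico, Finset.mem_range]
      omega
    · simp only [Finset.mem_Ico, Finset.mem_range, Finset.mem_union]
      omega
  -- If `s ≤ a` the two edges meet around the low vertices and cover `range m`; otherwise they meet
  -- inside the block and cover it.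
  · have key : ∀ s a, 1 ≤ s → s < m → 1 ≤ a → a < m →
        (Finset.range m ⊆ Finset.Ico s (s + k) ∪
          (Finset.Ico (m + k + 1 + a - k) (m + k + 1) ∪ Finset.range a)) ∨
        (Finset.Ico m (m + k + 1) ⊆ Finset.Ico s (s + k) ∪
          (Finset.Ico (m + k + 1 + a - k) (m + k + 1) ∪ Finset.range a)) := by
      intro s a hs hsm ha ham
      by_cases h : s ≤ a
      · left
        intro y
        simp only [Finset.mem_Ico, Finset.mem_union, Finset.mem_range]
        omega
      · right
        intro y
        simp only [Finset.mem_Ico, Finset.mem_union, Finset.mem_range]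
        omega
    rintro _ (⟨s, hs, hsm, rfl⟩ | ⟨a, ha, ham, rfl⟩)
    · refine ⟨m + k, by simp; omega, ?_⟩
      rintro f (((rfl | rfl | rfl) | ⟨j, hj, rfl⟩) | (⟨s', hs1, _, rfl⟩ | ⟨a, ha, ham, rfl⟩)) hx
      · rw [Finset.mem_range] at hx
        omega
      · simp at hx
      · refine ⟨Finset.Ico m (m + k), Or.inl (Or.inr (Or.inl rfl)), by simp, ?_⟩
        intro y
        simp only [Finset.mem_Ico, Finset.mem_union]
        omega
      · rw [Finset.mem_singleton] at hx
        omega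
      · rw [Finset.mem_Ico] at hx
        omega
      · rw [Finset.union_comm]
        rcases key s a hs hsm ha ham with h | h
        · exact ⟨_, Or.inl (Or.inl rfl), by simp, h⟩
        · refine ⟨Finset.Ico m (m + k), Or.inl (Or.inr (Or.inl rfl)), by simp, ?_⟩
          exact (Finset.Ico_subset_Ico le_rfl (by omega)).trans h
    · refine ⟨m, by simp; omega, ?_⟩
      rintro f (((rfl | rfl | rfl) | ⟨j, hj, rfl⟩) | (⟨s, hs, hsm, rfl⟩ | ⟨b, hb, hbm, rfl⟩)) hx
      · simp at hx
      · refine ⟨Finset.Ico (m + 1) (m + 1 + k), Or.inl (Or.inr (Or.inr rfl)), by simp, ?_⟩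
        intro y
        simp only [Finset.mem_Ico, Finset.mem_union, Finset.mem_range]
        omega
      · simp at hx
      · rw [Finset.mem_singleton] at hx
        omega
      · rcases key s a hs hsm ha ham with h | h
        · exact ⟨_, Or.inl (Or.inl rfl), by simp, h⟩
        · refine ⟨Finset.Ico (m + 1) (m + 1 + k), Or.inl (Or.inr (Or.inr rfl)), by simp, ?_⟩
          exact (Finset.Ico_subset_Ico (by omega) (by omega)).trans h
      · simp only [Finset.mem_Ico, Finset.mem_union, Finset.mem_range] at hx
        omega

/-! ### Base cases. -/

theorem betti_indep_beyond_zero (i : ℤ) : betti (indep (beyond 0)) i = if i = -1 then 1 else 0 := by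
  refine betti_empty (fun σ => ⟨fun h => ?_, ?_⟩) i
  · by_contra hne
    obtain ⟨x, hx⟩ := Finset.nonempty_iff_ne_empty.2 hne
    exact h {x} ⟨x, Nat.zero_le _, rfl⟩ (Finset.singleton_subset_iff.2 hx)
  · rintro rfl _ ⟨j, _, rfl⟩ h
    simp at h

/-- The homology of the boundary of a simplex with `m` vertices. -/
theorem betti_simplex_boundary {m : ℕ} (hm : 0 < m) (i : ℤ) :
    betti (indep ({Finset.range m} ∪ beyond m)) i = if i = (m : ℤ) - 2 then 1 else 0 := by
  obtain ⟨m, rfl⟩ : ∃ l, m = l + 1 := ⟨m - 1, by omega⟩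
  -- A simplex boundary is its own join with `{∅}`, so the suspension count applies with an empty
  -- first factor.
  have h := betti_indep_join_simplex (G := ∅) (m := 0) (by simp) m i
  rw [Set.empty_union, Set.empty_union, betti_indep_beyond_zero, zero_add,
    ← Finset.range_eq_Ico] at h
  rw [h]
  congr 1
  apply propext
  push_cast
  omega

theorem intervals_self (k : ℕ) : intervals k k = {Finset.range k} := by
  ext f
  constructor
  · rintro ⟨s, hs, rfl⟩
    obtain rfl : s = 0 := by omega
    rw [zero_add, ← Finset.range_eq_Ico]
    rfl
  · rintro rfl
    exact ⟨0, by omega, by rw [zero_add, Finset.range_eq_Ico]⟩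

/-- On `k` vertices every wrap is the whole vertex set, so the degenerate cycle has a single edge.
-/
theorem betti_cycle_self {k : ℕ} (hk : 0 < k) (i : ℤ) :
    betti (indep (intervals k k ∪ wraps k k ∪ beyond k)) i = if i = (k : ℤ) - 2 then 1 else 0 := by
  rw [← betti_simplex_boundary hk, intervals_self,
    Set.union_eq_self_of_subset_right (s := {Finset.range k}) (t := wraps k k)]
  rintro _ ⟨a, ha, hak, rfl⟩
  rw [Set.mem_singleton_iff]
  ext y
  simp only [Finset.mem_Ico, Finset.mem_union, Finset.mem_range]
  omega

/-- The edges are exactly the complements of single vertices, that is, all `k`-subsets, so the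
complex is a skeleton of the simplex. -/
theorem betti_cycle_succ {k : ℕ} (hk : 0 < k) (i : ℤ) :
    betti (indep (intervals (k + 1) k ∪ wraps (k + 1) k ∪ beyond (k + 1))) i =
      if i = (k : ℤ) - 2 then k else 0 := by
  refine betti_skeleton hk (S := Finset.range (k + 1)) (by simp) (fun σ => ?_) i
  have hrange : (∀ e ∈ beyond (k + 1), ¬ e ⊆ σ) ↔ σ ⊆ Finset.range (k + 1) := by
    constructor
    · intro h y hy
      by_contra hn
      rw [Finset.mem_range, not_lt] at hn
      exact h {y} ⟨y, hn, rfl⟩ (Finset.singleton_subset_iff.2 hy)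
    · rintro h _ ⟨j, hj, rfl⟩ hjσ
      have := Finset.mem_range.1 (h (Finset.singleton_subset_iff.1 hjσ))
      omega
  have herase : ∀ e, e ∈ intervals (k + 1) k ∪ wraps (k + 1) k ↔
      ∃ a ∈ Finset.range (k + 1), e = (Finset.range (k + 1)).erase a := by
    intro e
    constructor
    · rintro (⟨s, hs, rfl⟩ | ⟨a, ha, hak, rfl⟩)
      -- The interval starting at `0` misses `k`, and the only other one, starting at `1`, misses
      -- `0`; the wrap of parameter `a` misses `a`.
      · refine ⟨if s = 0 then k else 0, by split_ifs <;> simp, ?_⟩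
        ext y
        simp only [Finset.mem_Ico, Finset.mem_erase, Finset.mem_range]
        split_ifs <;> omega
      · refine ⟨a, by simp; omega, ?_⟩
        ext y
        simp only [Finset.mem_Ico, Finset.mem_erase, Finset.mem_range, Finset.mem_union]
        omega
    · rintro ⟨a, ha, rfl⟩
      rw [Finset.mem_range] at ha
      by_cases h0 : a = 0
      · refine Or.inl ⟨1, by omega, ?_⟩
        ext y
        simp only [Finset.mem_Ico, Finset.mem_erase, Finset.mem_range]
        omega
      by_cases h1 : a = k
      · refine Or.inl ⟨0, by omega, ?_⟩
        ext y
        simp only [Finset.mem_Ico, Finset.mem_erase, Finset.mem_range]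
        omega
      · refine Or.inr ⟨a, by omega, by omega, ?_⟩
        ext y
        simp only [Finset.mem_Ico, Finset.mem_erase, Finset.mem_range, Finset.mem_union]
        omega
  constructor
  · intro h
    have hσ := hrange.1 fun e he => h e (Or.inr he)
    refine ⟨hσ, ?_⟩
    by_contra hn
    obtain ⟨a, ha, haσ⟩ : ∃ a ∈ Finset.range (k + 1), (Finset.range (k + 1)).erase a ⊆ σ := by
      have hcard := Finset.card_sdiff_of_subset hσ
      rw [Finset.card_range] at hcard
      rcases (Finset.range (k + 1) \ σ).eq_empty_or_nonempty with h' | ⟨a, ha⟩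
      · rw [Finset.sdiff_eq_empty_iff_subset] at h'
        exact ⟨0, by simp, (Finset.erase_subset _ _).trans h'⟩
      · refine ⟨a, (Finset.mem_sdiff.1 ha).1, fun y hy => ?_⟩
        by_contra hyσ
        refine (Finset.mem_erase.1 hy).1 (Finset.card_le_one.1 (by omega : _ ≤ 1) y ?_ a ha)
        exact Finset.mem_sdiff.2 ⟨Finset.mem_of_mem_erase hy, hyσ⟩
    exact h _ (Or.inl ((herase _).2 ⟨a, ha, rfl⟩)) haσ
  · rintro ⟨h1, h2⟩ e (he | he) heσ
    · obtain ⟨a, ha, rfl⟩ := (herase e).1 he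
      have := Finset.card_le_card heσ
      rw [Finset.card_erase_of_mem ha, Finset.card_range] at this
      omega
    · exact hrange.2 h1 e he heσ

end Independence

/-! ### Iterating the recursion. -/

section Cycles

theorem betti_path_add_mul {k : ℕ} (hk : 0 < k) (r q : ℕ) (i : ℤ) :
    betti (indep (intervals (q * (k + 1) + r) k ∪ beyond (q * (k + 1) + r))) i =
      betti (indep (intervals r k ∪ beyond r)) (i - q * (k - 1)) := by
  induction q generalizing i with
  | zero => simp
  | succ q ih =>
    rw [show (q + 1) * (k + 1) + r = (q * (k + 1) + r) + k + 1 by ring, betti_path_step hk, ih]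
    congr 1
    push_cast
    ring

theorem betti_path_self {k : ℕ} (hk : 0 < k) (q : ℕ) (i : ℤ) :
    betti (indep (intervals (q * (k + 1) + k) k ∪ beyond (q * (k + 1) + k))) i =
      if i = q * (k - 1) + k - 2 then 1 else 0 := by
  rw [betti_path_add_mul hk, intervals_self, betti_simplex_boundary hk]
  congr 1
  apply propext
  constructor <;> intro h <;> linarith

theorem intervals_of_lt {n k : ℕ} (h : n < k) : intervals n k = ∅ := by
  rw [Set.eq_empty_iff_forall_notMem]
  rintro _ ⟨s, hs, rfl⟩
  omega

theorem betti_path_succ {k : ℕ} (hk : 0 < k) (q : ℕ) (i : ℤ) :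
    betti (indep (intervals ((q + 1) * (k + 1)) k ∪ beyond ((q + 1) * (k + 1)))) i =
      if i = q * (k - 1) + k - 2 then 1 else 0 := by
  rw [← add_zero ((q + 1) * (k + 1)), betti_path_add_mul hk, intervals_of_lt hk, Set.empty_union,
    betti_indep_beyond_zero]
  congr 1
  apply propext
  push_cast
  constructor <;> intro h <;> linarith

/-- The remaining `r` vertices carry no edge and span a full simplex, which is nonempty since `r >
0`, hence a cone. -/
theorem betti_path_of_lt {k r : ℕ} (hr : 0 < r) (hrk : r < k) (q : ℕ) (i : ℤ) :
    betti (indep (intervals (q * (k + 1) + r) k ∪ beyond (q * (k + 1) + r))) i = 0 := by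
  rw [betti_path_add_mul (by omega), intervals_of_lt hrk, Set.empty_union]
  refine betti_eq_zero_of_cone 0 ?_ _
  rintro σ hσ _ ⟨j, hj, rfl⟩ h
  rw [Finset.singleton_subset_iff, Finset.mem_insert] at h
  rcases h with h | h
  · omega
  · exact hσ {j} ⟨j, hj, rfl⟩ (Finset.singleton_subset_iff.2 h)

/-- The residual length `r` must be at least `k`, as each step needs `k ≤ m`; so the base cases have
`r` between `k + 1` and `2 * k + 1` rather than a remainder modulo `k + 1`. -/
theorem betti_cycle_add_mul {k : ℕ} (hk : 0 < k) {r : ℕ} (hr : k ≤ r) (q : ℕ) (i : ℤ) :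
    betti (indep (intervals (q * (k + 1) + r) k ∪ wraps (q * (k + 1) + r) k ∪
      beyond (q * (k + 1) + r))) i =
      betti (indep (intervals r k ∪ wraps r k ∪ beyond r)) (i - q * (k - 1)) := by
  induction q generalizing i with
  | zero => simp
  | succ q ih =>
    rw [show (q + 1) * (k + 1) + r = (q * (k + 1) + r) + k + 1 by ring,
      betti_cycle_step hk (hr.trans (Nat.le_add_left _ _)), ih]
    congr 1
    push_cast
    ring

theorem betti_cycle_mul {k : ℕ} (hk : 0 < k) (q : ℕ) (i : ℤ) :
    betti (indep (intervals ((q + 1) * (k + 1)) k ∪ wraps ((q + 1) * (k + 1)) k ∪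
      beyond ((q + 1) * (k + 1)))) i = if i = q * (k - 1) + k - 2 then k else 0 := by
  rw [show (q + 1) * (k + 1) = q * (k + 1) + (k + 1) by ring,
    betti_cycle_add_mul hk (Nat.le_succ k), betti_cycle_succ hk]
  congr 1
  apply propext
  constructor <;> intro h <;> linarith

theorem betti_cycle_mul_add {k : ℕ} {t : ℕ} (ht : 1 ≤ t) (htk : t ≤ k) (q : ℕ) (i : ℤ) :
    betti (indep (intervals ((q + 1) * (k + 1) + t) k ∪ wraps ((q + 1) * (k + 1) + t) k ∪
      beyond ((q + 1) * (k + 1) + t))) i = if i = q * (k - 1) + k + t - 3 then 1 else 0 := by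
  rw [show (q + 1) * (k + 1) + t = q * (k + 1) + (t + k + 1) by ring,
    betti_cycle_add_mul (by omega) (by omega)]
  -- For `t = k` one more step reaches the degenerate cycle on `k` vertices; for `t < k` the short
  -- cycle argument applies.
  rcases eq_or_lt_of_le htk with rfl | htk
  · rw [betti_cycle_step (by omega) le_rfl, betti_cycle_self (by omega)]
    congr 1
    apply propext
    constructor <;> intro h <;> linarith
  · rw [betti_short_cycle (by omega) htk, betti_simplex_boundary (by omega)]
    congr 1
    apply propext
    constructor <;> intro h <;> linarith

/-! ### Transfer to the given hypergraphs. -/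

/-- A family of finite sets pulled back along an embedding. -/
def comap {α β : Type*} (f : α ↪ β) (K : LowerSet (Finset β)) : LowerSet (Finset α) where
  carrier := {σ | σ.map f ∈ K}
  lower' := fun _ _ hle hσ => K.lower (Finset.map_subset_map.2 hle) hσ

theorem lt_of_mem_indep {E : Set (Finset ℕ)} {n y : ℕ} {τ : Finset ℕ}
    (hτ : τ ∈ indep (E ∪ beyond n)) (hy : y ∈ τ) : y < n := by
  by_contra hn
  exact hτ {y} (Or.inr ⟨y, not_lt.1 hn, rfl⟩) (Finset.singleton_subset_iff.2 hy)

theorem exists_map_eq {α β : Type*} (f : α ↪ β) (τ : Finset β)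
    (h : ∀ y ∈ τ, ∃ x, f x = y) : ∃ σ : Finset α, σ.map f = τ := by
  classical
  refine ⟨τ.preimage f f.injective.injOn, ?_⟩
  ext y
  simp only [Finset.mem_map, Finset.mem_preimage]
  constructor
  · rintro ⟨x, hx, rfl⟩
    exact hx
  · intro hy
    obtain ⟨x, rfl⟩ := h y hy
    exact ⟨x, hy, rfl⟩

theorem betti_tightPath {α : Type*} [DecidableEq α] {n : ℕ} (v : Fin n ↪ α) (k : ℕ) (i : ℤ) :
    betti (Hypergraph.tightPath v k).independenceComplex i =
      betti (indep (intervals n k ∪ beyond n)) i := by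
  -- Both complexes are compared with one on `Fin n`, which embeds in both vertex types; `α` and `ℕ`
  -- need not embed in each other.
  rw [← betti_eq_of_embedding Fin.valEmbedding (K := comap Fin.valEmbedding _) (fun _ => Iff.rfl),
    betti_eq_of_embedding v]
  · intro σ
    have hedge : ∀ s, s + k ≤ n →
        (v '' {j : Fin n | s ≤ (j : ℕ) ∧ (j : ℕ) < s + k} ⊆ (σ.map v : Set α) ↔
          Finset.Ico s (s + k) ⊆ σ.map Fin.valEmbedding) := by
      intro s hs
      rw [Finset.coe_map, Set.image_subset_image_iff v.injective]
      constructor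
      · intro h y hy
        rw [Finset.mem_Ico] at hy
        exact Finset.mem_map.2 ⟨⟨y, by omega⟩, h hy, rfl⟩
      · intro h y hy
        obtain ⟨x, hx, hxy⟩ := Finset.mem_map.1 (h (Finset.mem_Ico.2 hy))
        obtain rfl : x = y := Fin.ext hxy
        exact hx
    constructor
    · rintro ⟨-, h⟩ f (⟨s, hs, rfl⟩ | ⟨j, hj, rfl⟩) hf
      · exact h _ ⟨s, hs, rfl⟩ ((hedge s hs).2 hf)
      · obtain ⟨x, -, rfl⟩ := Finset.mem_map.1 (Finset.singleton_subset_iff.1 hf)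
        exact absurd x.2 (not_lt.2 hj)
    · intro h
      refine ⟨?_, ?_⟩
      · rw [Finset.coe_map]
        exact Set.image_subset_range _ _
      · rintro _ ⟨s, hs, rfl⟩ he
        exact h _ (Or.inl ⟨s, hs, rfl⟩) ((hedge s hs).1 he)
  · intro τ hτ
    exact exists_map_eq v τ fun y hy => hτ.1 hy
  · intro τ hτ
    exact exists_map_eq _ τ fun y hy => ⟨⟨y, lt_of_mem_indep hτ hy⟩, rfl⟩

theorem betti_tightCycle {n k : ℕ} (hk : 0 < k) (hkn : k < n) (i : ℤ) :
    betti (Hypergraph.tightCycle n k).independenceComplex i =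
      betti (indep (intervals n k ∪ wraps n k ∪ beyond n)) i := by
  have : NeZero n := ⟨by omega⟩
  let f : ZMod n ↪ ℕ := ⟨ZMod.val, ZMod.val_injective n⟩
  have hfc : ∀ s, s < n → f (s : ZMod n) = s := fun s hs => ZMod.val_cast_of_lt hs
  -- Under `ZMod.val` the arc from `x` becomes an interval if it does not pass `n`, and otherwise
  -- the wrap with parameter `f x + k - n`.
  let arc : ZMod n → Finset (ZMod n) := fun x => (Finset.range k).image fun j : ℕ => x + (j : ZMod n)
  have hmem : ∀ x y, y ∈ (arc x).map f ↔
      ∃ j < k, y = if f x + j < n then f x + j else f x + j - n := by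
    intro x y
    simp only [arc, Finset.mem_map, Finset.mem_image, Finset.mem_range, exists_exists_and_eq_and]
    refine exists_congr fun j => and_congr_right fun hj => ?_
    have hx : f x < n := ZMod.val_lt x
    have : f (x + (j : ZMod n)) = if f x + j < n then f x + j else f x + j - n := by
      change (x + (j : ZMod n)).val = _
      rw [ZMod.val_add, ZMod.val_cast_of_lt (hj.trans hkn)]
      change (f x + j) % n = _
      split_ifs with h
      · exact Nat.mod_eq_of_lt h
      · rw [Nat.mod_eq_sub_mod (not_lt.1 h), Nat.mod_eq_of_lt (by omega)]
    rw [this]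
    exact eq_comm
  have hint : ∀ x, f x + k ≤ n → (arc x).map f = Finset.Ico (f x) (f x + k) := by
    intro x hx
    ext y
    rw [hmem, Finset.mem_Ico]
    constructor
    · rintro ⟨j, hj, rfl⟩
      split_ifs <;> omega
    · rintro ⟨h1, h2⟩
      refine ⟨y - f x, by omega, ?_⟩
      rw [if_pos (by omega)]
      omega
  have hwrap : ∀ x, n < f x + k →
      (arc x).map f = Finset.Ico (n + (f x + k - n) - k) n ∪ Finset.range (f x + k - n) := by
    intro x hx
    have hxn : f x < n := ZMod.val_lt x
    ext y
    rw [hmem, Finset.mem_union, Finset.mem_Ico, Finset.mem_range]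
    constructor
    · rintro ⟨j, hj, rfl⟩
      split_ifs <;> omega
    · rintro (⟨h1, h2⟩ | h)
      · refine ⟨y - f x, by omega, ?_⟩
        rw [if_pos (by omega)]
        omega
      · refine ⟨y + n - f x, by omega, ?_⟩
        rw [if_neg (by omega)]
        omega
  have harc : ∀ x (σ : Finset (ZMod n)),
      {y : ZMod n | ∃ j : ℕ, j < k ∧ y = x + (j : ZMod n)} ⊆ (σ : Set (ZMod n)) ↔
        (arc x).map f ⊆ σ.map f := by
    intro x σ
    rw [Finset.map_subset_map]
    constructor
    · intro h y hy
      obtain ⟨j, hj, rfl⟩ := Finset.mem_image.1 hy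
      exact h ⟨j, Finset.mem_range.1 hj, rfl⟩
    · rintro h _ ⟨j, hj, rfl⟩
      exact h (Finset.mem_image.2 ⟨j, Finset.mem_range.2 hj, rfl⟩)
  refine betti_eq_of_embedding f (fun σ => ?_) (fun τ hτ => ?_) i
  · constructor
    · intro h
      refine ⟨Set.subset_univ _, ?_⟩
      rintro _ ⟨x, rfl⟩ hx
      rw [harc] at hx
      have hxn : f x < n := ZMod.val_lt x
      by_cases hxk : f x + k ≤ n
      · rw [hint x hxk] at hx
        exact h _ (Or.inl (Or.inl ⟨_, hxk, rfl⟩)) hx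
      · rw [hwrap x (by omega)] at hx
        exact h _ (Or.inl (Or.inr ⟨_, by omega, by omega, rfl⟩)) hx
    · rintro ⟨-, h⟩ e ((⟨s, hs, rfl⟩ | ⟨a, ha, hak, rfl⟩) | ⟨j, hj, rfl⟩) he
      · refine h _ ⟨(s : ZMod n), rfl⟩ ((harc _ _).2 ?_)
        rwa [hint _ (by rw [hfc s (by omega)]; omega), hfc s (by omega)]
      · refine h _ ⟨((n + a - k : ℕ) : ZMod n), rfl⟩ ((harc _ _).2 ?_)
        have hs := hfc (n + a - k) (by omega)
        rwa [hwrap _ (by omega), hs, show n + a - k + k - n = a by omega]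
      · obtain ⟨x, -, hx⟩ := Finset.mem_map.1 (Finset.singleton_subset_iff.1 he)
        have hxn : f x < n := ZMod.val_lt x
        omega
  · exact exists_map_eq _ τ fun y hy => ⟨(y : ZMod n), hfc y (lt_of_mem_indep hτ hy)⟩

end Cycles

end ReducedHomology

theorem mainTheorem6 (n k : ℕ) (hn : 0 < n) (hk : 0 < k) :
    (∀ (α : Type*) [DecidableEq α] (v : Fin n ↪ α) (i : ℤ),
      ((∃ q : ℕ, i = (q : ℤ) * ((k : ℤ) - 1) + (k : ℤ) - 2 ∧
          (n = q * (k + 1) + k ∨ n = (q + 1) * (k + 1))) →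
        ReducedHomology.betti (Hypergraph.tightPath v k).independenceComplex i = 1) ∧
      ((¬ ∃ q : ℕ, i = (q : ℤ) * ((k : ℤ) - 1) + (k : ℤ) - 2 ∧
          (n = q * (k + 1) + k ∨ n = (q + 1) * (k + 1))) →
        ReducedHomology.betti (Hypergraph.tightPath v k).independenceComplex i = 0)) ∧
    (k < n → ∀ i : ℤ,
      ((∃ q : ℕ, i = (q : ℤ) * ((k : ℤ) - 1) + (k : ℤ) - 2 ∧ n = (q + 1) * (k + 1)) →
        ReducedHomology.betti (Hypergraph.tightCycle n k).independenceComplex i = k) ∧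
      ((∃ q t : ℕ, 1 ≤ t ∧ t ≤ k ∧
          i = (q : ℤ) * ((k : ℤ) - 1) + (k : ℤ) + (t : ℤ) - 3 ∧ n = (q + 1) * (k + 1) + t) →
        ReducedHomology.betti (Hypergraph.tightCycle n k).independenceComplex i = 1) ∧
      ((¬ ∃ q : ℕ, i = (q : ℤ) * ((k : ℤ) - 1) + (k : ℤ) - 2 ∧ n = (q + 1) * (k + 1)) →
        (¬ ∃ q t : ℕ, 1 ≤ t ∧ t ≤ k ∧
          i = (q : ℤ) * ((k : ℤ) - 1) + (k : ℤ) + (t : ℤ) - 3 ∧ n = (q + 1) * (k + 1) + t) →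
        ReducedHomology.betti (Hypergraph.tightCycle n k).independenceComplex i = 0)) := by
  obtain ⟨q, r, hr, hnq⟩ : ∃ q r, r ≤ k ∧ n = q * (k + 1) + r :=
    ⟨n / (k + 1), n % (k + 1), Nat.lt_succ_iff.1 (Nat.mod_lt _ (Nat.succ_pos k)), by
      rw [mul_comm, Nat.div_add_mod]⟩
  constructor
  · intro α _ v i
    rw [ReducedHomology.betti_tightPath]
    constructor
    · rintro ⟨p, hi, h | h⟩
      · rw [h, ReducedHomology.betti_path_self hk, if_pos hi]
      · rw [h, ReducedHomology.betti_path_succ hk, if_pos hi]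
    · intro h
      rcases Nat.eq_zero_or_pos r with rfl | hr0
      · obtain ⟨p, rfl⟩ : ∃ p, q = p + 1 := by
          refine ⟨q - 1, (Nat.succ_pred_eq_of_pos (Nat.pos_of_ne_zero ?_)).symm⟩
          rintro rfl
          omega
        rw [add_zero] at hnq
        rw [hnq, ReducedHomology.betti_path_succ hk, if_neg]
        exact fun hi => h ⟨p, hi, Or.inr hnq⟩
      rcases eq_or_lt_of_le hr with rfl | hrk
      · rw [hnq, ReducedHomology.betti_path_self hk, if_neg]
        exact fun hi => h ⟨q, hi, Or.inl hnq⟩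
      · rw [hnq, ReducedHomology.betti_path_of_lt hr0 hrk]
  · intro hkn i
    rw [ReducedHomology.betti_tightCycle hk hkn]
    refine ⟨?_, ?_, ?_⟩
    · rintro ⟨p, hi, h⟩
      rw [h, ReducedHomology.betti_cycle_mul hk, if_pos hi]
    · rintro ⟨p, t, ht, htk, hi, h⟩
      rw [h, ReducedHomology.betti_cycle_mul_add ht htk, if_pos hi]
    · intro h1 h2
      -- Since `r ≤ k < n`, at least one full block of `k + 1` vertices is present.
      obtain ⟨p, rfl⟩ : ∃ p, q = p + 1 := by
        refine ⟨q - 1, (Nat.succ_pred_eq_of_pos (Nat.pos_of_ne_zero ?_)).symm⟩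
        rintro rfl
        omega
      rcases Nat.eq_zero_or_pos r with rfl | hr0
      · rw [add_zero] at hnq
        rw [hnq, ReducedHomology.betti_cycle_mul hk, if_neg]
        exact fun hi => h1 ⟨p, hi, hnq⟩
      · rw [hnq, ReducedHomology.betti_cycle_mul_add hr0 hr, if_neg]
        exact fun hi => h2 ⟨p, r, hr0, hr, hi, hnq⟩
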